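/- **The hierarchical Kondo model with magnetic field.** Let $N\ge 0$, $\beta=2^N$, $\lambda_0\in\mathbb R$, and let $\boldsymbol\omega\in\mathbb R^3$ be a unit vector. For $m=0,-1,\dots,-N$ let $\mathcal Q_m$ be the set of the $2^{N+m}$ boxes $\Delta=[i2^{|m|},(i+1)2^{|m|})\subset[0,\beta)$, with lower and upper halves $\Delta_-,\Delta_+$ (for $m<0$ these are boxes of $\mathcal Q_{m+1}$). To each half-box attach Grassmann variables $\psi^{[m]\pm}_\alpha(\Delta_\eta)$, $\varphi^{[m]\pm}_\alpha(\Delta_\eta)$, $\alpha\in\{\uparrow,\downarrow\}$, $\eta=\pm$. Averages $\langle\cdot\rangle$ are computed by the Wick rule with $\langle\psi^{[m]-}_\alpha(\Delta_{-\eta})\psi^{[m]+}_\alpha(\Delta_\eta)\rangle=\langle\varphi^{[m]-}_\alpha(\Delta_{-\eta})\varphi^{[m]+}_\alpha(\Delta_\eta)\rangle=\eta$, all other propagators being $0$; $\langle\cdot\rangle_m$ is the average over the fields on scale $m$ only. Put $\psi^{[\le m]\pm}_\alpha(\Delta_\eta)=2^{-1/2}\psi^{[\le m-1]\pm}_\alpha(\Delta)+\psi^{[m]\pm}_\alpha(\Delta_\eta)$,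 $\varphi^{[\le m]\pm}_\alpha(\Delta_\eta)=\varphi^{[\le m-1]\pm}_\alpha(\Delta)+\varphi^{[m]\pm}_\alpha(\Delta_\eta)$, the fields with $m<-N$ being $0$. With the Pauli matrices $\sigma^j$ let $A^j_\eta=\sum_{\alpha,\alpha'}\psi^{[\le m]+}_\alpha(\Delta_\eta)\sigma^j_{\alpha\alpha'}\psi^{[\le m]-}_{\alpha'}(\Delta_\eta)$, let $B^j_\eta$ be the same with $\varphi$, and let $O_{n,\eta}^{[\le m]}(\Delta)$, $n=0,\dots,8$, be $\tfrac12$ times $$\mathbf A\cdot\mathbf B,\ \ \mathbf A^2,\ \ \mathbf B^2,\ \ \mathbf A^2\mathbf B^2,\ \ \mathbf A\cdot\boldsymbol\omega,\ \ \mathbf B\cdot\boldsymbol\omega,\ \ (\mathbf A\cdot\boldsymbol\omega)(\mathbf B\cdot\boldsymbol\omega),\ \ \mathbf A^2(\mathbf B\cdot\boldsymbol\omega),\ \ \mathbf B^2(\mathbf A\cdot\boldsymbol\omega)$$ ($\mathbf A=\mathbf A_\eta$, $\mathbf B=\mathbf B_\eta$). Let $O_n^{[\le m-1]}(\Delta)$,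 $\Delta\in\mathcal Q_m$, be the same operators built from $\psi^{[\le m-1]}(\Delta),\varphi^{[\le m-1]}(\Delta)$. For $h\in\mathbb R$ let $V_h=-h\sum_j\omega_j\int_0^\beta B^j\,dt-\lambda_0\sum_j\int_0^\beta A^jB^j\,dt$, where the integrands are built from $\psi^{[\le0]},\varphi^{[\le0]}$ on the half-box of length $\tfrac12$ containing $t$. Put $V_h^{[0]}=V_h$ and $\beta c_h^{[m]}+V_h^{[m-1]}=-\log\langle e^{-V_h^{[m]}}\rangle_m$ with $c_h^{[m]}$ a constant and $V_h^{[m-1]}$ without constant term. Put $Z_h=\langle e^{-V_h}\rangle$, $f_h=-\beta^{-1}\log Z_h$, $\chi(h,\beta)=-\partial_h^2f_h$. Define the map $\boldsymbol\alpha\mapsto\boldsymbol\ell=\Lambda(\boldsymbol\alpha)$ on $\mathbb R^9$ by $$\begin{aligned} \ell_0&=\alpha_0,\quad \ell_1=\alpha_1+\tfrac1{12}\alpha_4^2,\quad \ell_2=\alpha_2+\tfrac1{12}\alpha_5^2,\quad \ell_4=\alpha_4,\quad \ell_5=\alpha_5,\quad \ell_6=\alpha_6+\tfrac12\alpha_4\alpha_5,\\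 \ell_3&=\alpha_3+\tfrac1{12}\alpha_0^2+\tfrac1{18}\alpha_0\alpha_6+\tfrac12\alpha_1\alpha_2+\tfrac16\alpha_4\alpha_8+\tfrac16\alpha_5\alpha_7+\tfrac1{36}\alpha_6^2+\tfrac1{36}\alpha_0\alpha_4\alpha_5\\ &\quad+\tfrac1{24}\alpha_1\alpha_5^2+\tfrac1{24}\alpha_2\alpha_4^2+\tfrac1{36}\alpha_4\alpha_5\alpha_6+\tfrac1{288}\alpha_4^2\alpha_5^2,\\ \ell_7&=\alpha_7+\tfrac16\alpha_0\alpha_4+\tfrac12\alpha_1\alpha_5+\tfrac16\alpha_4\alpha_6+\tfrac1{24}\alpha_4^2\alpha_5,\\ \ell_8&=\alpha_8+\tfrac16\alpha_0\alpha_5+\tfrac12\alpha_2\alpha_4+\tfrac16\alpha_5\alpha_6+\tfrac1{24}\alpha_4\alpha_5^2, \end{aligned}$$ and the map $\boldsymbol\ell\mapsto\widetilde{\mathcal R}(\boldsymbol\ell)=C(\boldsymbol\ell)^{-1}(r_0,\dots,r_8)$ by $$\begin{aligned} C&=1+2\ell_0^2+(\ell_0+\ell_6)^2+9\ell_1^2+9\ell_2^2+324\ell_3^2+\tfrac12\ell_4^2+\tfrac12\ell_5^2+18\ell_7^2+18\ell_8^2,\\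 r_0&=\ell_0-2\ell_0\ell_6+18\ell_0\ell_3+3\ell_0\ell_2+3\ell_0\ell_1-2\ell_0^2,\\ r_1&=\tfrac12\ell_1+9\ell_2\ell_3+\tfrac32\ell_8^2+\tfrac1{12}\ell_6^2+\tfrac12\ell_5\ell_7+\tfrac1{24}\ell_4^2+\tfrac16\ell_0\ell_6+\tfrac14\ell_0^2,\\ r_2&=2\ell_2+36\ell_1\ell_3+\ell_0^2+6\ell_7^2+\tfrac13\ell_6^2+\tfrac16\ell_5^2+2\ell_4\ell_8+\tfrac23\ell_0\ell_6,\\ r_3&=\tfrac12\ell_3+\tfrac14\ell_1\ell_2+\tfrac1{24}\ell_0^2+\tfrac1{36}\ell_0\ell_6+\tfrac1{72}\ell_6^2+\tfrac1{12}\ell_5\ell_7+\tfrac1{12}\ell_4\ell_8,\\ r_4&=\ell_4+6\ell_6\ell_7+\ell_5\ell_6+108\ell_3\ell_8+18\ell_2\ell_8+3\ell_1\ell_4+6\ell_0\ell_7+\ell_0\ell_5,\\ r_5&=2\ell_5+12\ell_6\ell_8+2\ell_4\ell_6+216\ell_3\ell_7+6\ell_2\ell_5+36\ell_1\ell_7+12\ell_0\ell_8+2\ell_0\ell_4,\\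 r_6&=\ell_6+18\ell_7\ell_8+3\ell_5\ell_8+3\ell_4\ell_7+\tfrac12\ell_4\ell_5+18\ell_3\ell_6+3\ell_2\ell_6+3\ell_1\ell_6+2\ell_0\ell_6,\\ r_7&=\tfrac12\ell_7+\tfrac12\ell_6\ell_8+\tfrac1{12}\ell_4\ell_6+\tfrac32\ell_3\ell_5+\tfrac32\ell_2\ell_7+\tfrac14\ell_1\ell_5+\tfrac12\ell_0\ell_8+\tfrac1{12}\ell_0\ell_4,\\ r_8&=\ell_8+\ell_6\ell_7+\tfrac16\ell_5\ell_6+3\ell_3\ell_4+\tfrac12\ell_2\ell_4+3\ell_1\ell_8+\ell_0\ell_7+\tfrac16\ell_0\ell_5. \end{aligned}$$ **Theorem.** 1. $\Lambda$ is a bijection of $\mathbb R^9$, and $C\ge1$ everywhere. 2. For $-N\le m\le 0$, each box $\Delta\in\mathcal Q_m$, $\eta=\pm$ and each $\boldsymbol\alpha\in\mathbb R^9$, with $\boldsymbol\ell=\Lambda(\boldsymbol\alpha)$, $$e^{\sum_n\alpha_nO_{n,\eta}^{[\le m]}(\Delta)}=\sum_{k=0}^4\frac1{k!}\Big(\sum_{n=0}^8\alpha_nO_{n,\eta}^{[\le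 m]}(\Delta)\Big)^k=1+\sum_{n=0}^8\ell_nO_{n,\eta}^{[\le m]}(\Delta),$$ and for each $\boldsymbol\ell\in\mathbb R^9$, $$\Big\langle\prod_{\eta=\pm}\Big(1+\sum_{n=0}^8\ell_nO_{n,\eta}^{[\le m]}(\Delta)\Big)\Big\rangle_m=C(\boldsymbol\ell)\Big(1+\sum_{n=0}^8\widetilde{\mathcal R}(\boldsymbol\ell)_nO_n^{[\le m-1]}(\Delta)\Big).$$ 3. For each $\lambda_0$ there are $\boldsymbol\alpha_h^{[m]},\boldsymbol\ell_h^{[m]}\in\mathbb R^9$ ($h\in\mathbb R$, $m=0,-1,-2,\dots$), independent of $\beta$ and $\boldsymbol\omega$, with $\boldsymbol\alpha_h^{[0]}=(\lambda_0,0,0,0,0,h,0,0,0)$, $\boldsymbol\ell_h^{[m]}=\Lambda(\boldsymbol\alpha_h^{[m]})$, $\boldsymbol\ell_h^{[m-1]}=\widetilde{\mathcal R}(\boldsymbol\ell_h^{[m]})$, such that the following holds with $C_h^{[m]}=C(\boldsymbol\ell_h^{[m]})$. For all $\boldsymbol\omega$, $\beta=2^N$, $h$ and $-N\le m\le0$,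 $$-V_h^{[m]}=\sum_{\Delta\in\mathcal Q_m}\sum_{n=0}^8\alpha_{n,h}^{[m]}\sum_{\eta=\pm}O_{n,\eta}^{[\le m]}(\Delta),\qquad c_h^{[m]}=-2^m\log C_h^{[m]},$$ $$Z_h=\prod_{m=-N}^0\big(C_h^{[m]}\big)^{2^{N+m}},\qquad f_h=\sum_{m=-N}^0c_h^{[m]}.$$ Moreover $f_h$ is smooth in $h$, and $$\chi(h,\beta)=\sum_{m=-N}^02^m\Big(\frac{\partial_h^2C_h^{[m]}}{C_h^{[m]}}-\frac{(\partial_hC_h^{[m]})^2}{(C_h^{[m]})^2}\Big).$$ The maps $C$, $\widetilde{\mathcal R}$ and $h\mapsto\boldsymbol\ell_h^{[m]}$ are smooth, and the derivatives in this formula are computed recursively from $$\partial_hC_h^{[m]}=DC(\boldsymbol\ell)[\partial_h\boldsymbol\ell],\qquad \partial_h^2C_h^{[m]}=D^2C(\boldsymbol\ell)[\partial_h\boldsymbol\ell,\partial_h\boldsymbol\ell]+DC(\boldsymbol\ell)[\partial_h^2\boldsymbol\ell],$$ $$\partial_h\boldsymbol\ell_h^{[m-1]}=D\widetilde{\mathcal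 R}(\boldsymbol\ell)[\partial_h\boldsymbol\ell],\qquad \partial_h^2\boldsymbol\ell_h^{[m-1]}=D^2\widetilde{\mathcal R}(\boldsymbol\ell)[\partial_h\boldsymbol\ell,\partial_h\boldsymbol\ell]+D\widetilde{\mathcal R}(\boldsymbol\ell)[\partial_h^2\boldsymbol\ell],$$ where $\boldsymbol\ell=\boldsymbol\ell_h^{[m]}$ on the right. -/

import Mathlib

open scoped ContDiff

noncomputable section

namespace HierKondo

/-! ### Fields -/

/-- The two kinds of fermions: the electron field `ψ` and the impurity field `φ`. -/
inductive Species where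
  | electron
  | impurity
  deriving DecidableEq

/-- Labels of the elementary fields.  The time axis `[0, ∞)` is paved on scale `m = -n` (`n ≥ 0`)
by the boxes `[i 2^n, (i+1) 2^n)`, `i ∈ ℕ`.  Box `i` has the two halves number `2 i` (lower half,
`η = -`) and `2 i + 1` (upper half, `η = +`); the half-box number `k` on scale `-n` is
`[k 2^(n-1), (k+1) 2^(n-1))`, so that for `n ≥ 1` it is the box number `k` on scale `-(n-1)`.

The model at inverse temperature `β = 2^N` only involves the labels with `scale ≤ N` and
`half < 2 ^ (N - scale + 1)`. -/
@[ext]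
structure Label where
  /-- electron `ψ` or impurity `φ` -/
  species : Species
  /-- `true` for the superscript `+`, `false` for the superscript `-` -/
  plus : Bool
  /-- spin, `0` is up and `1` is down -/
  spin : Fin 2
  /-- `n = |m| = -m` -/
  scale : ℕ
  /-- number of the half-box -/
  half : ℕ
  deriving DecidableEq

/-- The complex vector space spanned by the elementary fields. -/
abbrev FieldSpace : Type := Label →₀ ℂ

/-- The Grassmann algebra generated by the elementary fields. -/
abbrev Grassmann : Type := ExteriorAlgebra ℂ FieldSpace

/-- The elementary field with a given label. -/
def field (x : Label) : Grassmann := ExteriorAlgebra.ι ℂ (Finsupp.single x 1)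

/-- The coefficient of `1` (field-independent term) of an element of the Grassmann algebra. -/
def constTerm : Grassmann →ₐ[ℂ] ℂ := ExteriorAlgebra.algebraMapInv

/-! ### Propagators and the Wick rule -/

/-- The sign `η` of a half-box: `-1` for a lower half, `+1` for an upper half. -/
def eta (k : ℕ) : ℂ := if k % 2 = 0 then -1 else 1

/-- The propagator `⟨x y⟩`.  It vanishes unless the fields are of the same species, spin and scale,
have opposite superscripts, and live in the two different halves of one box; in that case
`⟨x⁻(Δ_{-η}) y⁺(Δ_η)⟩ = η`, and `⟨y⁺ x⁻⟩ = -⟨x⁻ y⁺⟩`. -/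
def propagator (x y : Label) : ℂ :=
  if x.species = y.species ∧ x.spin = y.spin ∧ x.scale = y.scale ∧ x.plus ≠ y.plus ∧
      x.half / 2 = y.half / 2 ∧ x.half ≠ y.half then
    (if y.plus then eta y.half else -eta x.half)
  else 0

theorem propagator_antisymm (x y : Label) : propagator x y = -propagator y x := by
  unfold propagator
  by_cases h : x.species = y.species ∧ x.spin = y.spin ∧ x.scale = y.scale ∧ x.plus ≠ y.plus ∧
      x.half / 2 = y.half / 2 ∧ x.half ≠ y.half
  · have h' : y.species = x.species ∧ y.spin = x.spin ∧ y.scale = x.scale ∧ y.plus ≠ x.plus ∧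
        y.half / 2 = x.half / 2 ∧ y.half ≠ x.half := by
      obtain ⟨a, b, c, d, e, f⟩ := h
      exact ⟨a.symm, b.symm, c.symm, d.symm, e.symm, f.symm⟩
    rw [if_pos h, if_pos h']
    have hd := h.2.2.2.1
    cases hx : x.plus <;> cases hy : y.plus <;> simp_all
  · have h' : ¬ (y.species = x.species ∧ y.spin = x.spin ∧ y.scale = x.scale ∧ y.plus ≠ x.plus ∧
        y.half / 2 = x.half / 2 ∧ y.half ≠ x.half) := by
      rintro ⟨a, b, c, d, e, f⟩
      exact h ⟨a.symm, b.symm, c.symm, d.symm, e.symm, f.symm⟩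
    rw [if_neg h, if_neg h', neg_zero]

open Classical in
/-- The covariance of the fields whose scale belongs to `S`, as a bilinear form. -/
def covariance (S : Set ℕ) : LinearMap.BilinForm ℂ FieldSpace :=
  Finsupp.linearCombination ℂ fun x => Finsupp.linearCombination ℂ fun y =>
    if x.scale ∈ S ∧ y.scale ∈ S then propagator x y else 0

open Classical in
theorem covariance_single (S : Set ℕ) (x y : Label) :
    covariance S (Finsupp.single x 1) (Finsupp.single y 1) =
      if x.scale ∈ S ∧ y.scale ∈ S then propagator x y else 0 := by
  simp [covariance]

theorem covariance_antisymm (S : Set ℕ) (v w : FieldSpace) :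
    covariance S v w = -covariance S w v := by
  have h : covariance S = -(covariance S).flip := by
    refine Finsupp.lhom_ext' fun x => LinearMap.ext_ring ?_
    refine Finsupp.lhom_ext' fun y => LinearMap.ext_ring ?_
    change covariance S (Finsupp.single x 1) (Finsupp.single y 1) =
      -covariance S (Finsupp.single y 1) (Finsupp.single x 1)
    rw [covariance_single, covariance_single]
    by_cases h1 : x.scale ∈ S <;> by_cases h2 : y.scale ∈ S <;>
      simp [h1, h2, propagator_antisymm x y]
  have := congrArg (fun f : LinearMap.BilinForm ℂ FieldSpace => f v w) h
  simpa using this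

theorem covariance_self (S : Set ℕ) (v : FieldSpace) : covariance S v v = 0 :=
  self_eq_neg.mp (covariance_antisymm S v v)

theorem covariance_toQuadraticMap (S : Set ℕ) :
    LinearMap.BilinMap.toQuadraticMap (-covariance S) =
      (0 : QuadraticForm ℂ FieldSpace) - 0 := by
  ext v
  simp [covariance_self]

open Classical in
/-- The linear map on the span of the fields that sets to `0` the fields with scale in `S` and
keeps all the others. -/
def dropFields (S : Set ℕ) : FieldSpace →ₗ[ℂ] FieldSpace :=
  Finsupp.linearCombination ℂ fun x => if x.scale ∈ S then 0 else Finsupp.single x 1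

/-- The average over the fields whose scale belongs to `S`, the other fields being external: the
linear map on the Grassmann algebra given by the Wick rule.  The map
`CliffordAlgebra.changeForm` performs all the contractions, after which the fields that
are left over and have scale in `S` are set to `0`.
The Wick rule itself is `average_one` and `average_ι_mul`, which characterize this map. -/
def average (S : Set ℕ) : Grassmann →ₗ[ℂ] Grassmann :=
  (ExteriorAlgebra.map (dropFields S)).toLinearMap ∘ₗ
    CliffordAlgebra.changeForm (covariance_toQuadraticMap S)

theorem average_one (S : Set ℕ) : average S 1 = 1 := by
  simp [average]

/-- The Wick rule: the first field is either external, or is contracted in turn with each one of the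
fields that follow it (`contractLeft` is the signed sum over these fields). -/
theorem average_ι_mul (S : Set ℕ) (v : FieldSpace) (x : Grassmann) :
    average S (ExteriorAlgebra.ι ℂ v * x) =
      ExteriorAlgebra.ι ℂ (dropFields S v) * average S x +
        average S (CliffordAlgebra.contractLeft (covariance S v) x) := by
  have h := CliffordAlgebra.changeForm_ι_mul (covariance_toQuadraticMap S) v x
  simp only [average, LinearMap.comp_apply, CliffordAlgebra.changeForm_contractLeft]
  erw [h]
  simp only [LinearMap.neg_apply, map_neg, sub_neg_eq_add, map_add, AlgHom.toLinearMap_apply,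
    map_mul]
  congr 2
  exact ExteriorAlgebra.map_apply_ι _ _

/-- The average `⟨·⟩` over all the fields. -/
def expectation (x : Grassmann) : ℂ := constTerm (average Set.univ x)

/-! ### Exponential and logarithm in the Grassmann algebra -/

/-- The exponential of a (nilpotent) element without constant term. -/
def gexp (x : Grassmann) : Grassmann :=
  ∑ k ∈ Finset.range (nilpotencyClass x), ((k.factorial : ℂ)⁻¹) • x ^ k

/-- The logarithm of an element `c (1 + u)` with constant term `c ≠ 0` (so that `u` is nilpotent):
`log c + ∑_{k ≥ 1} (-1)^{k+1} u^k / k`. -/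
def glog (x : Grassmann) : Grassmann :=
  let c : ℂ := constTerm x
  let u : Grassmann := c⁻¹ • x - 1
  algebraMap ℂ Grassmann (Complex.log c) +
    ∑ k ∈ Finset.Ico 1 (nilpotencyClass u), ((-1 : ℂ) ^ (k + 1) / (k : ℂ)) • u ^ k

/-! ### Fields on scales at most `m` and the operators built from them -/

/-- The dimensional factor attached to one step of scale: `2^{-1/2}` for the electrons and `1` for
the impurity. -/
def scaling : Species → ℂ
  | .electron => ((Real.sqrt 2 : ℝ) : ℂ)⁻¹
  | .impurity => 1

/-- The field `ψ^{[≤ m]}` (or `φ^{[≤ m]}`), `m = -n`, at the half-box number `k` on scale `-n`, for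
`β = 2^N`: the sum over the scales `m' = -(n + j)`, `m ≥ m' ≥ -N`, of
`2^{(m'-m)/2} ψ^{[m']}` (respectively `φ^{[m']}`), evaluated at the half-box on scale `m'` that
contains the given one.  It is `0` if `n > N`. -/
def lowField (N : ℕ) (s : Species) (p : Bool) (a : Fin 2) (n k : ℕ) : Grassmann :=
  ∑ j ∈ Finset.range (N + 1 - n), scaling s ^ j • field ⟨s, p, a, n + j, k / 2 ^ j⟩

/-- The recursive form of the definition: `ψ^{[≤ m]}(Δ_η) = 2^{-1/2} ψ^{[≤ m-1]}(Δ) + ψ^{[m]}(Δ_η)`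
and `φ^{[≤ m]}(Δ_η) = φ^{[≤ m-1]}(Δ) + φ^{[m]}(Δ_η)`. -/
theorem lowField_eq (N : ℕ) (s : Species) (p : Bool) (a : Fin 2) (n k : ℕ) (h : n ≤ N) :
    lowField N s p a n k =
      scaling s • lowField N s p a (n + 1) (k / 2) + field ⟨s, p, a, n, k⟩ := by
  unfold lowField
  rw [show N + 1 - n = (N + 1 - (n + 1)) + 1 by omega, Finset.sum_range_succ']
  simp only [pow_zero, one_smul, add_zero, Nat.div_one, Finset.smul_sum, smul_smul]
  congr 1
  refine Finset.sum_congr rfl fun j _ => ?_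
  rw [← pow_succ', Nat.div_div_eq_div_mul, ← pow_succ', add_assoc, add_comm 1 j]

/-- The Pauli matrices. -/
def pauli : Fin 3 → Matrix (Fin 2) (Fin 2) ℂ :=
  ![!![0, 1; 1, 0], !![0, -Complex.I; Complex.I, 0], !![1, 0; 0, -1]]

/-- The `j`-th component of the spin `∑ ψ⁺ σ^j ψ⁻` built from the fields on scales at most `-n`, at
the half-box number `k`.  It is the vector `A` for the electrons and `B` for the impurity. -/
def spinVec (N : ℕ) (s : Species) (n k : ℕ) (j : Fin 3) : Grassmann :=
  ∑ a : Fin 2, ∑ a' : Fin 2,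
    pauli j a a' • (lowField N s true a n k * lowField N s false a' n k)

/-- Dot product of two vectors of Grassmann polynomials. -/
def dotG (X Y : Fin 3 → Grassmann) : Grassmann := ∑ j, X j * Y j

/-- Dot product of a vector of Grassmann polynomials with a real vector. -/
def dotR (X : Fin 3 → Grassmann) (dir : EuclideanSpace ℝ (Fin 3)) : Grassmann :=
  ∑ j, (dir j : ℂ) • X j

/-- The operators `O_0, …, O_8` on scale `m = -n` at the half-box number `k`.  With `k = 2 i` or
`k = 2 i + 1` these are `O_{p,-}^{[≤ m]}(Δ)` and `O_{p,+}^{[≤ m]}(Δ)` for the box `Δ` number `i` on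
scale `m`. -/
def op (dir : EuclideanSpace ℝ (Fin 3)) (N n k : ℕ) : Fin 9 → Grassmann :=
  let A := spinVec N .electron n k
  let B := spinVec N .impurity n k
  ![(1 / 2 : ℂ) • dotG A B,
    (1 / 2 : ℂ) • dotG A A,
    (1 / 2 : ℂ) • dotG B B,
    (1 / 2 : ℂ) • (dotG A A * dotG B B),
    (1 / 2 : ℂ) • dotR A dir,
    (1 / 2 : ℂ) • dotR B dir,
    (1 / 2 : ℂ) • (dotR A dir * dotR B dir),
    (1 / 2 : ℂ) • (dotG A A * dotR B dir),
    (1 / 2 : ℂ) • (dotG B B * dotR A dir)]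

/-- Real linear combinations of the nine operators at a half-box. -/
def opComb (dir : EuclideanSpace ℝ (Fin 3)) (N n k : ℕ) (a : Fin 9 → ℝ) : Grassmann :=
  ∑ p, (a p : ℂ) • op dir N n k p

/-! ### The model -/

/-- The integral `∫ dt F` over `[0, 2^N]` of a function of time that is constant, with value `F k`,
on each half-box `[k/2, (k+1)/2)` of scale `0`. -/
def timeIntegral (N : ℕ) (F : ℕ → Grassmann) : Grassmann :=
  ∑ k ∈ Finset.range (2 ^ (N + 1)), (1 / 2 : ℂ) • F k

/-- The interaction `V_h(ψ, φ) = -h ∑_j dir_j ∫ dt B^j(t) - λ₀ ∑_j ∫ dt A^j(t) B^j(t)` at `β = 2^N`,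
where `A^j` and `B^j` are the spins of the fields `ψ(0,t)`, `φ(t)`. -/
def interaction (lam : ℝ) (dir : EuclideanSpace ℝ (Fin 3)) (N : ℕ) (h : ℝ) : Grassmann :=
  -((h : ℂ) • ∑ j : Fin 3, (dir j : ℂ) • timeIntegral N fun k => spinVec N .impurity 0 k j) -
    (lam : ℂ) • ∑ j : Fin 3, timeIntegral N fun k =>
      spinVec N .electron 0 k j * spinVec N .impurity 0 k j

/-- `-log ⟨e^{-V}⟩_m`, `m = -n`, where the average is over the fields on scale `m`. -/
def integrateScale (n : ℕ) (V : Grassmann) : Grassmann := -glog (average {n} (gexp (-V)))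

/-- The effective potential `V_h^{[m]}`, `m = -n`: it starts from `V_h^{[0]} = V_h`, and
`V_h^{[m-1]}` is `-log ⟨e^{-V_h^{[m]}}⟩_m` without its constant term. -/
def effPot (lam : ℝ) (dir : EuclideanSpace ℝ (Fin 3)) (N : ℕ) (h : ℝ) : ℕ → Grassmann
  | 0 => interaction lam dir N h
  | n + 1 =>
    let W := integrateScale n (effPot lam dir N h n)
    W - algebraMap ℂ Grassmann (constTerm W)

/-- The number `c_h^{[m]}`, `m = -n`: `β c_h^{[m]}`, `β = 2^N`, is the constant term of
`-log ⟨e^{-V_h^{[m]}}⟩_m`. -/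
def freeTerm (lam : ℝ) (dir : EuclideanSpace ℝ (Fin 3)) (N : ℕ) (h : ℝ) (n : ℕ) : ℂ :=
  ((2 : ℂ) ^ N)⁻¹ * constTerm (integrateScale n (effPot lam dir N h n))

/-- The partition function `Z_h = ⟨e^{-V_h}⟩` at `β = 2^N`. -/
def partitionFn (lam : ℝ) (dir : EuclideanSpace ℝ (Fin 3)) (N : ℕ) (h : ℝ) : ℂ :=
  expectation (gexp (-interaction lam dir N h))

/-- The free energy `f_h = -β⁻¹ log Z_h` at `β = 2^N`. -/
def freeEnergy (lam : ℝ) (dir : EuclideanSpace ℝ (Fin 3)) (N : ℕ) (h : ℝ) : ℝ :=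
  -((2 : ℝ) ^ N)⁻¹ * Real.log (partitionFn lam dir N h).re

/-- The impurity susceptibility `χ(h, β) = -∂²f_h/∂h²` at `β = 2^N`. -/
def susceptibility (lam : ℝ) (dir : EuclideanSpace ℝ (Fin 3)) (N : ℕ) (h : ℝ) : ℝ :=
  -deriv (deriv (freeEnergy lam dir N)) h

/-! ### The explicit maps -/

/-- The map from the couplings `α` to the couplings `ℓ`. -/
def alphaToEll (a : Fin 9 → ℝ) : Fin 9 → ℝ :=
  ![a 0,
    a 1 + 1 / 12 * a 4 ^ 2,
    a 2 + 1 / 12 * a 5 ^ 2,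
    a 3 + 1 / 12 * a 0 ^ 2 + 1 / 18 * (a 0 * a 6) + 1 / 2 * (a 1 * a 2) + 1 / 6 * (a 4 * a 8)
      + 1 / 6 * (a 5 * a 7) + 1 / 36 * a 6 ^ 2 + 1 / 36 * (a 0 * a 4 * a 5)
      + 1 / 24 * (a 1 * a 5 ^ 2) + 1 / 24 * (a 2 * a 4 ^ 2) + 1 / 36 * (a 4 * a 5 * a 6)
      + 1 / 288 * (a 4 ^ 2 * a 5 ^ 2),
    a 4,
    a 5,
    a 6 + 1 / 2 * (a 4 * a 5),
    a 7 + 1 / 6 * (a 0 * a 4) + 1 / 2 * (a 1 * a 5) + 1 / 6 * (a 4 * a 6)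
      + 1 / 24 * (a 4 ^ 2 * a 5),
    a 8 + 1 / 6 * (a 0 * a 5) + 1 / 2 * (a 2 * a 4) + 1 / 6 * (a 5 * a 6)
      + 1 / 24 * (a 4 * a 5 ^ 2)]

/-- The constant `C` as a function of `ℓ`. -/
def betaC (l : Fin 9 → ℝ) : ℝ :=
  1 + 2 * l 0 ^ 2 + (l 0 + l 6) ^ 2 + 9 * l 1 ^ 2 + 9 * l 2 ^ 2 + 324 * l 3 ^ 2
    + 1 / 2 * l 4 ^ 2 + 1 / 2 * l 5 ^ 2 + 18 * l 7 ^ 2 + 18 * l 8 ^ 2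

/-- The beta function: the map from `ℓ^{[m]}` to `ℓ^{[m-1]}`. -/
def betaMap (l : Fin 9 → ℝ) : Fin 9 → ℝ := (betaC l)⁻¹ •
  ![l 0 - 2 * (l 0 * l 6) + 18 * (l 0 * l 3) + 3 * (l 0 * l 2) + 3 * (l 0 * l 1) - 2 * l 0 ^ 2,
    1 / 2 * l 1 + 9 * (l 2 * l 3) + 3 / 2 * l 8 ^ 2 + 1 / 12 * l 6 ^ 2 + 1 / 2 * (l 5 * l 7)
      + 1 / 24 * l 4 ^ 2 + 1 / 6 * (l 0 * l 6) + 1 / 4 * l 0 ^ 2,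
    2 * l 2 + 36 * (l 1 * l 3) + l 0 ^ 2 + 6 * l 7 ^ 2 + 1 / 3 * l 6 ^ 2 + 1 / 6 * l 5 ^ 2
      + 2 * (l 4 * l 8) + 2 / 3 * (l 0 * l 6),
    1 / 2 * l 3 + 1 / 4 * (l 1 * l 2) + 1 / 24 * l 0 ^ 2 + 1 / 36 * (l 0 * l 6)
      + 1 / 72 * l 6 ^ 2 + 1 / 12 * (l 5 * l 7) + 1 / 12 * (l 4 * l 8),
    l 4 + 6 * (l 6 * l 7) + l 5 * l 6 + 108 * (l 3 * l 8) + 18 * (l 2 * l 8) + 3 * (l 1 * l 4)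
      + 6 * (l 0 * l 7) + l 0 * l 5,
    2 * l 5 + 12 * (l 6 * l 8) + 2 * (l 4 * l 6) + 216 * (l 3 * l 7) + 6 * (l 2 * l 5)
      + 36 * (l 1 * l 7) + 12 * (l 0 * l 8) + 2 * (l 0 * l 4),
    l 6 + 18 * (l 7 * l 8) + 3 * (l 5 * l 8) + 3 * (l 4 * l 7) + 1 / 2 * (l 4 * l 5)
      + 18 * (l 3 * l 6) + 3 * (l 2 * l 6) + 3 * (l 1 * l 6) + 2 * (l 0 * l 6),
    1 / 2 * l 7 + 1 / 2 * (l 6 * l 8) + 1 / 12 * (l 4 * l 6) + 3 / 2 * (l 3 * l 5)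
      + 3 / 2 * (l 2 * l 7) + 1 / 4 * (l 1 * l 5) + 1 / 2 * (l 0 * l 8) + 1 / 12 * (l 0 * l 4),
    l 8 + l 6 * l 7 + 1 / 6 * (l 5 * l 6) + 3 * (l 3 * l 4) + 1 / 2 * (l 2 * l 4)
      + 3 * (l 1 * l 8) + l 0 * l 7 + 1 / 6 * (l 0 * l 5)]

end HierKondo

end

open scoped ContDiff

set_option linter.unusedSimpArgs false

noncomputable section

namespace HierKondo

open CliffordAlgebra (contractLeft changeForm)

/-! ### General properties of the average -/


/-! Everything takes place in a small commutative algebra attached to a half-box. The bilinears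
`ψ⁺ψ⁻` are even, hence central. Anticommutation reduces every product of two of them to `0` or to
`±` one quartic monomial, so `A^i A^j = δ_ij S`, `A^j S = 0`, `S² = 0` with `S = 𝐀²/3`. Thus each
species contributes the span of `1, A⁰, A¹, A², S`, and the nine operators are combinations of
products of two such bases. Since `ω` is a unit vector, the span of the nine operators is closed
under multiplication. Every operator has degree at least one in the spins, while the degree in `A`
and the degree in `B` are at most two, so five factors multiply to zero and the exponential is a
quartic polynomial. Its coefficients are the map `Λ`, which is triangular with respect to the degree
and hence invertible (`gexp_opComb`, `alphaToEll_bijective`).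

The average on one scale is governed by propagators that join only the two halves of one box and are
diagonal in species and spin. By `average_mul_of_orthogonal` it factorizes over boxes and over
species, so a renormalization step is a finite computation: a table of one-species averages
(`average_spinBasis_mul`) with parameter `κ = 1/2` for electrons and `κ = 1` for the impurity,
contracted with the coefficients of `1 + ∑ ℓ_n O_n`. That the result is again of this form, with
constant `C` and numerators `r_n`, is the polynomial identity `wick_coef`, valid modulo `|ω|² = 1`
and `i² = -1`.

Exponentiating back through `Λ⁻¹` gives `average_gexp_opSum`: the average of an exponential of
operators is a power of `C` times an exponential of the same kind on the next scale. The formal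
identity `log ∘ exp = id` (`glog_smul_gexp`) turns this into the flow of effective potentials. For
the partition function no logarithm is needed: by the tower property `average_average` the scales
are integrated one by one, and after the last one no field is left. As `C ≥ 1`, logarithms and
quotients are smooth in `h`, and the derivative formulas are the chain rule. -/

/-- Words in the generators span the subalgebra, so a linear property has to be checked only when
one field is put on the left. This matches the Wick recursion, which peels off the first field. -/
theorem adjoin_word_induction {U : Submodule ℂ FieldSpace} {p : Grassmann → Prop}
    (one : p 1) (add : ∀ x y, p x → p y → p (x + y)) (smul : ∀ (c : ℂ) x, p x → p (c • x))
    (ι_mul : ∀ v ∈ U, ∀ x ∈ Algebra.adjoin ℂ (ExteriorAlgebra.ι ℂ '' (U : Set FieldSpace)),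
      p x → p (ExteriorAlgebra.ι ℂ v * x))
    {x : Grassmann} (hx : x ∈ Algebra.adjoin ℂ (ExteriorAlgebra.ι ℂ '' (U : Set FieldSpace))) :
    p x := by
  have key : ∀ y ∈ Submonoid.closure (ExteriorAlgebra.ι ℂ '' (U : Set FieldSpace)), p y := by
    intro y hy
    induction hy using Submonoid.closure_induction_left with
    | one => exact one
    | mul_left a ha b hb ih =>
      obtain ⟨v, hv, rfl⟩ := ha
      refine ι_mul v hv b ?_ ih
      exact (Submonoid.closure_le (S := (Algebra.adjoin ℂ _).toSubmonoid)).2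
        Algebra.subset_adjoin hb
  rw [← Subalgebra.mem_toSubmodule, Algebra.adjoin_eq_span] at hx
  induction hx using Submodule.span_induction with
  | mem y hy => exact key y hy
  | zero => simpa using smul 0 1 one
  | add y z _ _ hy hz => exact add y z hy hz
  | smul c y _ hy => exact smul c y hy

/-- The subalgebra generated by a space of fields. -/
def fieldAlg (U : Submodule ℂ FieldSpace) : Subalgebra ℂ Grassmann :=
  Algebra.adjoin ℂ (ExteriorAlgebra.ι ℂ '' (U : Set FieldSpace))

theorem ι_mem_fieldAlg {U : Submodule ℂ FieldSpace} {v : FieldSpace} (hv : v ∈ U) :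
    ExteriorAlgebra.ι ℂ v ∈ fieldAlg U :=
  Algebra.subset_adjoin ⟨v, hv, rfl⟩

theorem contractLeft_mem_fieldAlg {U : Submodule ℂ FieldSpace} (d : Module.Dual ℂ FieldSpace)
    {x : Grassmann} (hx : x ∈ fieldAlg U) : contractLeft d x ∈ fieldAlg U := by
  refine adjoin_word_induction (U := U) (p := fun x => contractLeft d x ∈ fieldAlg U)
    ?_ ?_ ?_ ?_ hx
  · rw [CliffordAlgebra.contractLeft_one]; exact zero_mem _
  · intro x y hx hy
    rw [map_add]; exact add_mem hx hy
  · intro c x hx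
    rw [map_smul]; exact Subalgebra.smul_mem _ hx c
  · intro v hv x hx h
    have := CliffordAlgebra.contractLeft_ι_mul (Q := 0) d v x
    erw [this]
    exact sub_mem (Subalgebra.smul_mem _ hx _) (mul_mem (ι_mem_fieldAlg hv) h)

theorem contractLeft_eq_zero {U : Submodule ℂ FieldSpace} {d : Module.Dual ℂ FieldSpace}
    (hd : ∀ v ∈ U, d v = 0) {x : Grassmann} (hx : x ∈ fieldAlg U) : contractLeft d x = 0 := by
  refine adjoin_word_induction (U := U) (p := fun x => contractLeft d x = 0) ?_ ?_ ?_ ?_ hx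
  · exact CliffordAlgebra.contractLeft_one _ _
  · intro x y hx hy
    rw [map_add, hx, hy, add_zero]
  · intro c x hx
    rw [map_smul, hx, smul_zero]
  · intro v hv x _ h
    have := CliffordAlgebra.contractLeft_ι_mul (Q := 0) d v x
    erw [this]
    rw [hd v hv, h, zero_smul, mul_zero, sub_zero]

theorem contractLeft_ι_mul' (d : Module.Dual ℂ FieldSpace) (v : FieldSpace) (x : Grassmann) :
    contractLeft d (ExteriorAlgebra.ι ℂ v * x) =
      d v • x - ExteriorAlgebra.ι ℂ v * contractLeft d x :=
  CliffordAlgebra.contractLeft_ι_mul (Q := 0) d v x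

/-- In the graded Leibniz rule the parity sign of `x` multiplies only the contraction of `y`, which
is zero here; hence no parity assumption on `x`. -/
theorem contractLeft_mul_of_eq_zero (d : Module.Dual ℂ FieldSpace) (x : Grassmann)
    {y : Grassmann} (hy : contractLeft d y = 0) :
    contractLeft d (x * y) = contractLeft d x * y := by
  induction x using CliffordAlgebra.left_induction with
  | algebraMap r =>
    rw [CliffordAlgebra.contractLeft_algebraMap_mul, hy, CliffordAlgebra.contractLeft_algebraMap,
      mul_zero, zero_mul]
  | add a b ha hb => rw [add_mul, map_add, ha, hb, map_add, add_mul]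
  | ι_mul a v ha =>
    rw [mul_assoc, CliffordAlgebra.contractLeft_ι_mul, CliffordAlgebra.contractLeft_ι_mul, ha,
      sub_mul, smul_mul_assoc, mul_assoc]

/-- Composing the changes of form by `B` and `-B` gives a form that is provably, not definitionally,
zero; substitution reduces this case to `changeForm_self_apply`. -/
theorem changeForm_of_eq_zero {B : LinearMap.BilinForm ℂ FieldSpace}
    (hB : LinearMap.BilinMap.toQuadraticMap B = (0 : QuadraticForm ℂ FieldSpace) - 0)
    (h : B = 0) (x : Grassmann) : changeForm hB x = x := by
  subst h
  exact CliffordAlgebra.changeForm_self_apply x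

/-- The Wick recursion determines the average. -/
theorem eq_average (S : Set ℕ) (F : Grassmann →ₗ[ℂ] Grassmann) (h1 : F 1 = 1)
    (hF : ∀ v x, F (ExteriorAlgebra.ι ℂ v * x) =
      ExteriorAlgebra.ι ℂ (dropFields S v) * F x + F (contractLeft (covariance S v) x)) :
    F = average S := by
  have hneg := CliffordAlgebra.changeForm.neg_proof (covariance_toQuadraticMap S)
  -- The opposite change of form undoes all contractions. After it, the contraction terms in the
  -- recursion for `F` cancel and only the dropping of fields remains.
  have key : ∀ x : Grassmann, F (changeForm hneg x) = ExteriorAlgebra.map (dropFields S) x := by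
    intro x
    induction x using CliffordAlgebra.left_induction with
    | algebraMap r =>
      rw [CliffordAlgebra.changeForm_algebraMap]
      change F (algebraMap ℂ Grassmann r) =
        ExteriorAlgebra.map (dropFields S) (algebraMap ℂ Grassmann r)
      rw [AlgHom.commutes, Algebra.algebraMap_eq_smul_one, map_smul, h1]
    | add a b ha hb => rw [map_add, map_add, ha, hb, map_add]
    | ι_mul a v ha =>
      rw [CliffordAlgebra.changeForm_ι_mul, map_sub]
      have h2 := hF v (changeForm hneg a)
      have h3 : ExteriorAlgebra.map (dropFields S) (CliffordAlgebra.ι 0 v * a) =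
          ExteriorAlgebra.ι ℂ (dropFields S v) * ExteriorAlgebra.map (dropFields S) a := by
        rw [map_mul]; congr 1; exact ExteriorAlgebra.map_apply_ι _ _
      erw [h3, h2]
      rw [ha, show (- -covariance S) v = covariance S v by rw [neg_neg], add_sub_cancel_right]
  refine LinearMap.ext fun x => ?_
  have h4 := key (changeForm (covariance_toQuadraticMap S) x)
  rw [CliffordAlgebra.changeForm_changeForm] at h4
  rw [changeForm_of_eq_zero _ (add_neg_cancel _)] at h4
  exact h4

theorem average_ι (S : Set ℕ) (v : FieldSpace) :
    average S (ExteriorAlgebra.ι ℂ v) = ExteriorAlgebra.ι ℂ (dropFields S v) := by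
  have := average_ι_mul S v 1
  rwa [mul_one, average_one, mul_one, CliffordAlgebra.contractLeft_one, map_zero, add_zero] at this

/-- Contraction with a functional that factors through `dropFields` commutes with the average. -/
theorem contractLeft_average (S : Set ℕ) (d : Module.Dual ℂ FieldSpace) (x : Grassmann) :
    contractLeft d (average S x) = average S (contractLeft (d ∘ₗ dropFields S) x) := by
  have key : ∀ y : Grassmann, contractLeft d (ExteriorAlgebra.map (dropFields S) y) =
      ExteriorAlgebra.map (dropFields S) (contractLeft (d ∘ₗ dropFields S) y) := by
    intro y
    induction y using CliffordAlgebra.left_induction with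
    | algebraMap r =>
      rw [CliffordAlgebra.contractLeft_algebraMap, map_zero]
      have : ExteriorAlgebra.map (dropFields S) (algebraMap ℂ Grassmann r) =
        algebraMap ℂ Grassmann r := AlgHom.commutes _ _
      erw [this]
      exact CliffordAlgebra.contractLeft_algebraMap _ _ _
    | add a b ha hb => simp only [map_add, ha, hb]
    | ι_mul a v ha =>
      have h3 : ∀ w b, ExteriorAlgebra.map (dropFields S) (CliffordAlgebra.ι 0 w * b) =
          ExteriorAlgebra.ι ℂ (dropFields S w) * ExteriorAlgebra.map (dropFields S) b := by
        intro w b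
        rw [map_mul]; congr 1; exact ExteriorAlgebra.map_apply_ι _ _
      rw [CliffordAlgebra.contractLeft_ι_mul, map_sub, h3, h3, contractLeft_ι_mul', ha, map_smul]
      rfl
  simp only [average, LinearMap.comp_apply, AlgHom.toLinearMap_apply,
    CliffordAlgebra.changeForm_contractLeft, key]

theorem dropFields_single_mem {S : Set ℕ} {x : Label} (hx : x.scale ∈ S) (c : ℂ) :
    dropFields S (Finsupp.single x c) = 0 := by
  simp [dropFields, hx]

theorem dropFields_single_notMem {S : Set ℕ} {x : Label} (hx : x.scale ∉ S) (c : ℂ) :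
    dropFields S (Finsupp.single x c) = Finsupp.single x c := by
  simp [dropFields, hx]

theorem propagator_eq_zero_of_scale {x y : Label} (h : x.scale ≠ y.scale) :
    propagator x y = 0 := by
  simp [propagator, h]

/-- Propagators vanish between different scales, so the covariance is block diagonal: fields with
scale in `T` contract among themselves, and so do the fields that survive dropping `T`. -/
theorem covariance_drop {S T : Set ℕ} (h : T ⊆ S) (v : FieldSpace) :
    covariance S v =
      covariance S (dropFields T v) ∘ₗ dropFields T + covariance T v := by
  have : covariance S = (covariance S).compl₁₂ (dropFields T) (dropFields T) +
      covariance T := by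
    refine Finsupp.lhom_ext' fun x => LinearMap.ext_ring ?_
    refine Finsupp.lhom_ext' fun y => LinearMap.ext_ring ?_
    simp only [LinearMap.comp_apply, Finsupp.lsingle_apply, LinearMap.add_apply,
      LinearMap.compl₁₂_apply]
    by_cases hx : x.scale ∈ T <;> by_cases hy : y.scale ∈ T
    · rw [dropFields_single_mem hx, covariance_single, covariance_single]
      simp [hx, hy, h hx, h hy]
    · rw [dropFields_single_mem hx, covariance_single, covariance_single]
      have : x.scale ≠ y.scale := fun e => hy (e ▸ hx)
      simp [propagator_eq_zero_of_scale this]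
    · rw [dropFields_single_mem hy, covariance_single, covariance_single]
      have : x.scale ≠ y.scale := fun e => hx (e ▸ hy)
      simp [propagator_eq_zero_of_scale this]
    · rw [dropFields_single_notMem hx, dropFields_single_notMem hy, covariance_single,
        covariance_single]
      simp [hx]
  have := congrArg (fun f : LinearMap.BilinForm ℂ FieldSpace => f v) this
  exact this

theorem dropFields_dropFields {S T : Set ℕ} (h : T ⊆ S) (v : FieldSpace) :
    dropFields S (dropFields T v) = dropFields S v := by
  have : dropFields S ∘ₗ dropFields T = dropFields S := by
    refine Finsupp.lhom_ext' fun x => LinearMap.ext_ring ?_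
    simp only [LinearMap.comp_apply, Finsupp.lsingle_apply]
    by_cases hx : x.scale ∈ T
    · rw [dropFields_single_mem hx, map_zero, dropFields_single_mem (h hx)]
    · rw [dropFields_single_notMem hx]
  exact congrArg (fun f => f v) this

/-- Tower property of averages. -/
theorem average_average {S T : Set ℕ} (h : T ⊆ S) (x : Grassmann) :
    average S (average T x) = average S x := by
  have : average S ∘ₗ average T = average S := by
    refine eq_average S _ ?_ ?_
    · simp [average_one]
    · intro v x
      simp only [LinearMap.comp_apply]
      rw [average_ι_mul, map_add, average_ι_mul, contractLeft_average, dropFields_dropFields h,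
        add_assoc, ← map_add, ← map_add]
      congr 3
      -- A contraction of `v` is made by the inner average if its scale lies in `T`, and by the
      -- outer one otherwise; the two add up to the contraction over `S`.
      rw [covariance_drop h v, map_add, LinearMap.add_apply]
  exact congrArg (fun f => f x) this

/-- Averages factorize over orthogonal sets of fields. -/
theorem average_mul_of_orthogonal (S : Set ℕ) {U V : Submodule ℂ FieldSpace}
    (hUV : ∀ u ∈ U, ∀ v ∈ V, covariance S u v = 0) {x y : Grassmann}
    (hx : x ∈ fieldAlg U) (hy : y ∈ fieldAlg V) :
    average S (x * y) = average S x * average S y := by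
  set hB := covariance_toQuadraticMap S
  have hneg := CliffordAlgebra.changeForm.neg_proof hB
  have hinv : ∀ z, changeForm hneg (changeForm hB z) = z := by
    intro z
    rw [CliffordAlgebra.changeForm_changeForm]
    exact changeForm_of_eq_zero _ (add_neg_cancel _) _
  have hinv' : ∀ z, changeForm hB (changeForm hneg z) = z := by
    intro z
    rw [CliffordAlgebra.changeForm_changeForm]
    exact changeForm_of_eq_zero _ (neg_add_cancel _) _
  have hmem : ∀ z ∈ fieldAlg U, changeForm hB z ∈ fieldAlg U := by
    intro z hz
    refine adjoin_word_induction (U := U) (p := fun z => changeForm hB z ∈ fieldAlg U)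
      ?_ ?_ ?_ ?_ hz
    · rw [CliffordAlgebra.changeForm_one]; exact one_mem _
    · intro a b ha hb
      rw [map_add]; exact add_mem ha hb
    · intro c a ha
      rw [map_smul]; exact Subalgebra.smul_mem _ ha c
    · intro v hv a _ h
      have := CliffordAlgebra.changeForm_ι_mul hB v a
      erw [this]
      exact sub_mem (mul_mem (ι_mem_fieldAlg hv) h) (contractLeft_mem_fieldAlg _ h)
  -- Writing the first factor as `changeForm hneg z` lets the induction run on its contracted form
  -- `z`. Contraction with a field of `U` annihilates `y`, so it acts on the left factor alone.
  have key : ∀ z ∈ fieldAlg U,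
      changeForm hB (changeForm hneg z * y) = z * changeForm hB y := by
    intro z hz
    refine adjoin_word_induction (U := U)
      (p := fun z => changeForm hB (changeForm hneg z * y) = z * changeForm hB y)
      ?_ ?_ ?_ ?_ hz
    · rw [CliffordAlgebra.changeForm_one, one_mul, one_mul]
    · intro a b ha hb
      rw [map_add, add_mul, map_add, ha, hb, add_mul]
    · intro c a ha
      rw [map_smul, smul_mul_assoc, map_smul, ha, smul_mul_assoc]
    · intro v hv a _ h
      have h1 := CliffordAlgebra.changeForm_ι_mul hneg v a
      have h2 := CliffordAlgebra.changeForm_ι_mul hB v (changeForm hneg a * y)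
      have h3 : contractLeft (covariance S v) (changeForm hneg a * y) =
          contractLeft (covariance S v) (changeForm hneg a) * y :=
        contractLeft_mul_of_eq_zero _ _ (contractLeft_eq_zero (hUV v hv) hy)
      have h1' : changeForm hneg (ExteriorAlgebra.ι ℂ v * a) = CliffordAlgebra.ι 0 v *
          changeForm hneg a - contractLeft (- -covariance S v) (changeForm hneg a) := h1
      rw [h1', sub_mul, map_sub, mul_assoc, h2, h, neg_neg, ← h3,
        CliffordAlgebra.changeForm_contractLeft, h, mul_assoc, LinearMap.neg_apply, map_neg,
        LinearMap.neg_apply, sub_neg_eq_add, add_sub_cancel_right]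
  have hmul : changeForm hB (x * y) = changeForm hB x * changeForm hB y := by
    have := key _ (hmem x hx)
    rwa [hinv] at this
  change ExteriorAlgebra.map (dropFields S) (changeForm hB (x * y)) =
    ExteriorAlgebra.map (dropFields S) (changeForm hB x) *
      ExteriorAlgebra.map (dropFields S) (changeForm hB y)
  rw [hmul, map_mul]

/-- Products of two fields are central. -/
theorem ι_mul_ι_mem_center (v w : FieldSpace) :
    ExteriorAlgebra.ι ℂ v * ExteriorAlgebra.ι ℂ w ∈ Subalgebra.center ℂ Grassmann := by
  rw [Subalgebra.mem_center_iff]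
  intro x
  have h : ∀ a b : FieldSpace, ExteriorAlgebra.ι ℂ a * ExteriorAlgebra.ι ℂ b =
      -(ExteriorAlgebra.ι ℂ b * ExteriorAlgebra.ι ℂ a) := fun a b =>
    eq_neg_of_add_eq_zero_left (ExteriorAlgebra.ι_add_mul_swap a b)
  induction x using ExteriorAlgebra.induction with
  | algebraMap r => exact Algebra.commutes _ _
  | ι u =>
    rw [← mul_assoc, h u v, neg_mul, mul_assoc, h u w, mul_neg, neg_neg, mul_assoc]
  | mul a b ha hb => rw [mul_assoc, hb, ← mul_assoc, ha, mul_assoc]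
  | add a b ha hb => rw [add_mul, mul_add, ha, hb]

/-! ### Exponential and logarithm of nilpotent elements -/

open Polynomial in
-- Truncated form of `log (exp X) = X`. The truncated exponential `p` satisfies `p' = p - X^M/M!`,
-- and the derivative of the truncated logarithm is a geometric sum in `1 - p`, so the derivative of
-- the difference is divisible by `X^M`. As the difference has no constant term and the
-- characteristic is zero, one more power of `X` divides it.
theorem X_pow_dvd_log_exp_sub_X (M : ℕ) :
    (X : ℂ[X]) ^ (M + 1) ∣
      (∑ k ∈ Finset.Ico 1 (M + 1), C ((-1 : ℂ) ^ (k + 1) / (k : ℂ)) *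
        (∑ j ∈ Finset.range (M + 1), C ((j.factorial : ℂ)⁻¹) * X ^ j - 1) ^ k) - X := by
  set p : ℂ[X] := ∑ j ∈ Finset.range (M + 1), C ((j.factorial : ℂ)⁻¹) * X ^ j with hp
  have hX : (X : ℂ[X]) ∣ p - 1 := by
    rw [X_dvd_iff, hp, Finset.sum_range_succ']
    simp
  have hp' : derivative p = p - C ((M.factorial : ℂ)⁻¹) * X ^ M := by
    have h1 : p - C ((M.factorial : ℂ)⁻¹) * X ^ M =
        ∑ j ∈ Finset.range M, C ((j.factorial : ℂ)⁻¹) * X ^ j := by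
      rw [hp, Finset.sum_range_succ, add_sub_cancel_right]
    rw [h1, hp, Finset.sum_range_succ', map_add, map_sum]
    simp only [Nat.factorial_zero, Nat.cast_one, inv_one, map_one, pow_zero, mul_one,
      derivative_one, add_zero]
    refine Finset.sum_congr rfl fun j _ => ?_
    rw [derivative_C_mul_X_pow, Nat.add_sub_cancel, Nat.factorial_succ]
    congr 2
    have := Nat.factorial_ne_zero j
    have h2 : ((j + 1 : ℕ) : ℂ) ≠ 0 := Nat.cast_ne_zero.2 (Nat.succ_ne_zero j)
    push_cast at h2 ⊢
    field_simp
  set Q : ℂ[X] := (∑ k ∈ Finset.Ico 1 (M + 1), C ((-1 : ℂ) ^ (k + 1) / (k : ℂ)) * (p - 1) ^ k) - X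
    with hQ
  have hQ0 : Q.coeff 0 = 0 := by
    rw [← X_dvd_iff, hQ]
    refine dvd_sub (Finset.dvd_sum fun k hk => ?_) dvd_rfl
    exact Dvd.dvd.mul_left (dvd_pow hX (by have := Finset.mem_Ico.1 hk; omega)) _
  have hgeom : derivative Q = (∑ j ∈ Finset.range M, (1 - p) ^ j) * derivative p - 1 := by
    rw [hQ, map_sub, map_sum, derivative_X, Finset.sum_mul, Finset.sum_Ico_eq_sum_range]
    congr 1
    refine Finset.sum_congr (by simp) fun j _ => ?_
    rw [derivative_C_mul, derivative_pow, map_sub, derivative_one, sub_zero, add_comm 1 j,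
      Nat.add_sub_cancel, ← neg_sub p 1, neg_pow (p - 1) j]
    have h2 : ((j + 1 : ℕ) : ℂ) ≠ 0 := Nat.cast_ne_zero.2 (Nat.succ_ne_zero j)
    have h3 : C ((-1 : ℂ) ^ (j + 1 + 1) / ((j + 1 : ℕ) : ℂ)) * C (((j + 1 : ℕ) : ℂ)) =
        (-1 : ℂ[X]) ^ j := by
      rw [← C_mul, div_mul_cancel₀ _ h2, pow_succ, pow_succ]
      simp
    rw [← h3]; ring
  have hdvd : (X : ℂ[X]) ^ M ∣ derivative Q := by
    have h1 : derivative Q = -((1 - p) ^ M) -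
        (∑ j ∈ Finset.range M, (1 - p) ^ j) * C ((M.factorial : ℂ)⁻¹) * X ^ M := by
      have h2 := mul_neg_geom_sum (1 - p) M
      rw [sub_sub_cancel] at h2
      rw [hgeom, hp']
      linear_combination h2
    rw [h1]
    refine dvd_sub ?_ (Dvd.intro_left _ rfl)
    rw [dvd_neg]
    refine pow_dvd_pow_of_dvd ?_ M
    rw [← neg_sub p 1, dvd_neg]
    exact hX
  rw [X_pow_dvd_iff] at hdvd ⊢
  intro d hd
  rcases d with _ | d
  · exact hQ0
  · have := hdvd d (by omega)
    rw [coeff_derivative] at this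
    exact (mul_eq_zero.1 this).resolve_right (by exact_mod_cast Nat.succ_ne_zero d)

theorem gexp_eq_exp (x : Grassmann) : gexp x = IsNilpotent.exp x := by
  simp only [gexp, IsNilpotent.exp, ← Rat.cast_smul_eq_qsmul ℂ, Rat.cast_inv, Rat.cast_natCast]

theorem gexp_eq_sum {x : Grassmann} {k : ℕ} (h : x ^ k = 0) :
    gexp x = ∑ r ∈ Finset.range k, ((r.factorial : ℂ)⁻¹) • x ^ r := by
  rw [gexp_eq_exp, IsNilpotent.exp_eq_sum h]
  simp only [← Rat.cast_smul_eq_qsmul ℂ, Rat.cast_inv, Rat.cast_natCast]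

theorem gexp_add {x y : Grassmann} (hc : Commute x y) (hx : IsNilpotent x) (hy : IsNilpotent y) :
    gexp (x + y) = gexp x * gexp y := by
  simp only [gexp_eq_exp, IsNilpotent.exp_add_of_commute hc hx hy]

theorem gexp_zero : gexp 0 = 1 := by
  rw [gexp_eq_sum (k := 1) (by simp)]; simp

theorem constTerm_of_isNilpotent {x : Grassmann} (hx : IsNilpotent x) : constTerm x = 0 :=
  (hx.map constTerm).eq_zero

theorem constTerm_gexp {x : Grassmann} (hx : IsNilpotent x) : constTerm (gexp x) = 1 := by
  obtain ⟨k, hk⟩ := hx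
  rw [gexp_eq_sum (k := k + 1) (by rw [pow_succ, hk, zero_mul]), map_sum,
    Finset.sum_range_succ']
  simp [constTerm_of_isNilpotent ⟨k, hk⟩]

/-- The polynomial congruence is evaluated at the nilpotent `x`, where `X^(M+1)` becomes `0` and the
congruence becomes an equality. -/
theorem glog_smul_gexp {c : ℂ} (hc : c ≠ 0) {x : Grassmann} (hx : IsNilpotent x) :
    glog (c • gexp x) = algebraMap ℂ Grassmann (Complex.log c) + x := by
  have hct : constTerm (c • gexp x) = c := by rw [map_smul, constTerm_gexp hx, smul_eq_mul, mul_one]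
  unfold glog
  simp only [hct, smul_smul, inv_mul_cancel₀ hc, one_smul]
  congr 1
  obtain ⟨M, hM⟩ := hx
  have hM1 : x ^ (M + 1) = 0 := by rw [pow_succ, hM, zero_mul]
  have he : gexp x = Polynomial.aeval x (∑ j ∈ Finset.range (M + 1),
      Polynomial.C ((j.factorial : ℂ)⁻¹) * Polynomial.X ^ j) := by
    rw [gexp_eq_sum hM1, map_sum]
    refine Finset.sum_congr rfl fun j _ => ?_
    rw [map_mul, Polynomial.aeval_C, map_pow, Polynomial.aeval_X, Algebra.smul_def]
  have hu : (gexp x - 1) ^ (M + 1) = 0 := by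
    have hX : (Polynomial.X : Polynomial ℂ) ∣ (∑ j ∈ Finset.range (M + 1),
        Polynomial.C ((j.factorial : ℂ)⁻¹) * Polynomial.X ^ j) - 1 := by
      rw [Polynomial.X_dvd_iff, Finset.sum_range_succ']
      simp
    obtain ⟨q, hq⟩ := pow_dvd_pow_of_dvd hX (M + 1)
    have := congrArg (Polynomial.aeval x) hq
    rw [map_pow, map_sub, map_one, ← he, map_mul, map_pow, Polynomial.aeval_X, hM1,
      zero_mul] at this
    exact this
  have hsum : ∑ k ∈ Finset.Ico 1 (nilpotencyClass (gexp x - 1)),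
      ((-1 : ℂ) ^ (k + 1) / (k : ℂ)) • (gexp x - 1) ^ k =
      ∑ k ∈ Finset.Ico 1 (M + 1), ((-1 : ℂ) ^ (k + 1) / (k : ℂ)) • (gexp x - 1) ^ k := by
    -- The logarithm stops at the nilpotency class of `gexp x - 1`, which is at most `M + 1`; the
    -- extra terms are zero.
    refine Finset.sum_subset (Finset.Ico_subset_Ico_right (csInf_le' hu)) fun k hk hk' => ?_
    have h1 : nilpotencyClass (gexp x - 1) ≤ k := by
      simp only [Finset.mem_Ico, not_and, not_lt] at hk hk'
      exact hk' hk.1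
    rw [pow_eq_zero_of_le h1 (pow_nilpotencyClass ⟨_, hu⟩), smul_zero]
  rw [hsum]
  obtain ⟨q, hq⟩ := X_pow_dvd_log_exp_sub_X M
  have := congrArg (Polynomial.aeval x) hq
  rw [map_sub, map_mul, map_pow, Polynomial.aeval_X, hM1, zero_mul, sub_eq_zero] at this
  refine Eq.trans ?_ this
  rw [map_sum]
  refine Finset.sum_congr rfl fun k _ => ?_
  rw [map_mul, Polynomial.aeval_C, map_pow, map_sub, map_one, ← he, Algebra.smul_def]

/-! ### Spaces of fields -/

/-- The span of the fields with labels in `T`. -/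
def fieldsIn (T : Set Label) : Submodule ℂ FieldSpace := Finsupp.supported ℂ ℂ T

theorem single_mem_fieldsIn {T : Set Label} {x : Label} (hx : x ∈ T) (c : ℂ) :
    (Finsupp.single x c : FieldSpace) ∈ fieldsIn T :=
  Finsupp.single_mem_supported ℂ c hx

theorem fieldAlg_mono {T T' : Set Label} (h : T ⊆ T') :
    fieldAlg (fieldsIn T) ≤ fieldAlg (fieldsIn T') :=
  Algebra.adjoin_mono (Set.image_mono (Finsupp.supported_mono h))

theorem covariance_eq_zero {S : Set ℕ} {T T' : Set Label}
    (h : ∀ x ∈ T, ∀ y ∈ T', x.scale ∈ S → y.scale ∈ S → propagator x y = 0) :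
    ∀ u ∈ fieldsIn T, ∀ v ∈ fieldsIn T', covariance S u v = 0 := by
  intro u hu v hv
  rw [fieldsIn, Finsupp.supported_eq_span_single] at hu hv
  induction hu using Submodule.span_induction with
  | mem u hu =>
    obtain ⟨x, hx, rfl⟩ := hu
    induction hv using Submodule.span_induction with
    | mem v hv =>
      obtain ⟨y, hy, rfl⟩ := hv
      rw [covariance_single]
      split_ifs with hs
      · exact h x hx y hy hs.1 hs.2
      · rfl
    | zero => simp
    | add v w _ _ h1 h2 => rw [map_add, h1, h2, add_zero]
    | smul c v _ h1 => rw [map_smul, h1, smul_zero]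
  | zero => simp
  | add u w _ _ h1 h2 => rw [map_add, LinearMap.add_apply, h1, h2, add_zero]
  | smul c u _ h1 => rw [map_smul, LinearMap.smul_apply, h1, smul_zero]

/-- The vector of the field `lowField`. -/
def lowVec (N : ℕ) (s : Species) (p : Bool) (a : Fin 2) (n k : ℕ) : FieldSpace :=
  ∑ j ∈ Finset.range (N + 1 - n),
    scaling s ^ j • (Finsupp.single ⟨s, p, a, n + j, k / 2 ^ j⟩ 1 : FieldSpace)

theorem ι_lowVec (N : ℕ) (s : Species) (p : Bool) (a : Fin 2) (n k : ℕ) :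
    ExteriorAlgebra.ι ℂ (lowVec N s p a n k) = lowField N s p a n k := by
  simp only [lowVec, lowField, field, map_sum, map_smul]

theorem lowVec_eq (N : ℕ) (s : Species) (p : Bool) (a : Fin 2) (n k : ℕ) (h : n ≤ N) :
    lowVec N s p a n k = scaling s • lowVec N s p a (n + 1) (k / 2) +
      Finsupp.single ⟨s, p, a, n, k⟩ 1 := by
  have h1 := lowField_eq N s p a n k h
  rw [← ι_lowVec, ← ι_lowVec, field, ← map_smul, ← map_add, ExteriorAlgebra.ι_inj] at h1
  exact h1

/-- The label set records what the factorizations use: species, spin and, on the scale `n` only, the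
half-box. Fields of larger `n` are shared by several half-boxes, but they are external when the
scale `n` is integrated. -/
theorem lowVec_mem (N : ℕ) (s : Species) (p : Bool) (a : Fin 2) (n k : ℕ) :
    lowVec N s p a n k ∈ fieldsIn
      {x | x.species = s ∧ x.spin = a ∧ n ≤ x.scale ∧ (x.scale = n → x.half = k)} := by
  refine Submodule.sum_mem _ fun j _ => Submodule.smul_mem _ _ (single_mem_fieldsIn ?_ _)
  refine ⟨rfl, rfl, Nat.le_add_right _ _, fun h => ?_⟩
  -- Only the term `j = 0` lies on the scale `n`, and there `k / 2 ^ 0 = k`.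
  have : j = 0 := by simpa using h
  subst this
  simp

theorem dropFields_of_notMem {S : Set ℕ} {T : Set Label} (h : ∀ x ∈ T, x.scale ∉ S) :
    ∀ u ∈ fieldsIn T, dropFields S u = u := by
  intro u hu
  rw [fieldsIn, Finsupp.supported_eq_span_single] at hu
  induction hu using Submodule.span_induction with
  | mem u hu =>
    obtain ⟨x, hx, rfl⟩ := hu
    exact dropFields_single_notMem (h x hx) 1
  | zero => simp
  | add u w _ _ h1 h2 => rw [map_add, h1, h2]
  | smul c u _ h1 => rw [map_smul, h1]

theorem dropFields_lowVec (N : ℕ) (s : Species) (p : Bool) (a : Fin 2) (n k : ℕ) (h : n ≤ N) :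
    dropFields {n} (lowVec N s p a n k) = scaling s • lowVec N s p a (n + 1) (k / 2) := by
  rw [lowVec_eq N s p a n k h, map_add, map_smul, dropFields_single_mem (by simp), add_zero,
    dropFields_of_notMem (T := {x | n < x.scale})]
  · intro x hx
    exact (ne_of_gt hx : x.scale ≠ n)
  · exact Finsupp.supported_mono (fun x hx => hx.2.2.1) (lowVec_mem N s p a (n + 1) (k / 2))

theorem covariance_lowVec (N : ℕ) (s s' : Species) (p p' : Bool) (a a' : Fin 2) (n k k' : ℕ)
    (h : n ≤ N) :
    covariance {n} (lowVec N s p a n k) (lowVec N s' p' a' n k') =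
      propagator ⟨s, p, a, n, k⟩ ⟨s', p', a', n, k'⟩ := by
  have h1 : ∀ s p a k, lowVec N s p a (n + 1) k ∈ fieldsIn {x | n < x.scale} := fun s p a k =>
    Finsupp.supported_mono (fun x hx => hx.2.2.1) (lowVec_mem N s p a (n + 1) k)
  have hl : ∀ u ∈ fieldsIn {x | n < x.scale}, ∀ v ∈ fieldsIn Set.univ, covariance {n} u v = 0 :=
    covariance_eq_zero fun x hx y _ hs _ => absurd hs (ne_of_gt hx)
  have hr : ∀ u ∈ fieldsIn Set.univ, ∀ v ∈ fieldsIn {x | n < x.scale}, covariance {n} u v = 0 :=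
    covariance_eq_zero fun x _ y hy _ hs => absurd hs (ne_of_gt hy)
  have hu : ∀ v, v ∈ fieldsIn Set.univ := fun v => by simp [fieldsIn]
  rw [lowVec_eq N s p a n k h, lowVec_eq N s' p' a' n k' h]
  simp only [map_add, map_smul, LinearMap.add_apply, LinearMap.smul_apply]
  rw [hl _ (h1 _ _ _ _) _ (hu _), hl _ (h1 _ _ _ _) _ (hu _), hr _ (hu _) _ (h1 _ _ _ _),
    covariance_single]
  simp

/-! ### The spin algebra -/

/-- The product `ψ⁺_a ψ⁻_b`. -/
def bilin (N : ℕ) (s : Species) (n k : ℕ) (a b : Fin 2) : Grassmann :=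
  lowField N s true a n k * lowField N s false b n k

theorem bilin_mem_center (N : ℕ) (s : Species) (n k : ℕ) (a b : Fin 2) :
    bilin N s n k a b ∈ Subalgebra.center ℂ Grassmann := by
  rw [bilin, ← ι_lowVec, ← ι_lowVec]
  exact ι_mul_ι_mem_center _ _

theorem bilin_comm (N : ℕ) (s : Species) (n k : ℕ) (a b : Fin 2) (x : Grassmann) :
    bilin N s n k a b * x = x * bilin N s n k a b :=
  (Subalgebra.mem_center_iff.1 (bilin_mem_center N s n k a b) x).symm

theorem lowField_sq (N : ℕ) (s : Species) (p : Bool) (n k : ℕ) (a : Fin 2) :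
    lowField N s p a n k * lowField N s p a n k = 0 := by
  rw [← ι_lowVec]
  exact ExteriorAlgebra.ι_sq_zero _

theorem lowField_swap (N : ℕ) (s : Species) (n k : ℕ) (p p' : Bool) (a b : Fin 2) :
    lowField N s p a n k * lowField N s p' b n k =
      -(lowField N s p' b n k * lowField N s p a n k) := by
  rw [← ι_lowVec, ← ι_lowVec]
  exact eq_neg_of_add_eq_zero_left (ExteriorAlgebra.ι_add_mul_swap _ _)

theorem bilin_mul_left (N : ℕ) (s : Species) (n k : ℕ) (a b c : Fin 2) :
    bilin N s n k a b * bilin N s n k a c = 0 := by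
  rw [bilin_comm, bilin, bilin, mul_assoc, ← mul_assoc (lowField N s false c n k),
    lowField_swap N s n k false true, neg_mul, mul_neg, ← mul_assoc, ← mul_assoc, lowField_sq,
    zero_mul, zero_mul, neg_zero]

theorem bilin_mul_right (N : ℕ) (s : Species) (n k : ℕ) (a b c : Fin 2) :
    bilin N s n k a b * bilin N s n k c b = 0 := by
  rw [bilin, bilin, mul_assoc, lowField_swap N s n k true false c b,
    mul_neg, ← mul_assoc (lowField N s false b n k), lowField_sq, zero_mul, neg_zero, mul_zero]

/-- Exchanging the two anticommuting fields `ψ⁻` costs a sign. This is the Fierz identity that makes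
all quartic products proportional to one another. -/
theorem bilin_exchange (N : ℕ) (s : Species) (n k : ℕ) (a b c d : Fin 2) :
    bilin N s n k a b * bilin N s n k c d = -(bilin N s n k a d * bilin N s n k c b) := by
  have h : ∀ x y, lowField N s true a n k * lowField N s false x n k *
      (lowField N s true c n k * lowField N s false y n k) =
      -(lowField N s true a n k * (lowField N s true c n k *
        (lowField N s false x n k * lowField N s false y n k))) := by
    intro x y
    rw [mul_assoc, ← mul_assoc (lowField N s false x n k), lowField_swap N s n k false true,
      neg_mul, mul_neg, mul_assoc]
  rw [bilin, bilin, bilin, bilin, h, h, lowField_swap N s n k false false d b]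
  simp only [mul_neg, neg_neg]

theorem spinVec_zero (N : ℕ) (s : Species) (n k : ℕ) :
    spinVec N s n k 0 = bilin N s n k 0 1 + bilin N s n k 1 0 := by
  simp [spinVec, pauli, Fin.sum_univ_two, bilin]

theorem spinVec_one (N : ℕ) (s : Species) (n k : ℕ) :
    spinVec N s n k 1 = -Complex.I • bilin N s n k 0 1 + Complex.I • bilin N s n k 1 0 := by
  simp [spinVec, pauli, Fin.sum_univ_two, bilin]

theorem spinVec_two (N : ℕ) (s : Species) (n k : ℕ) :
    spinVec N s n k 2 = bilin N s n k 0 0 - bilin N s n k 1 1 := by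
  simp [spinVec, pauli, Fin.sum_univ_two, bilin, sub_eq_add_neg]

/-- The common square of the components of the spin. -/
def spinSq (N : ℕ) (s : Species) (n k : ℕ) : Grassmann :=
  (-2 : ℂ) • (bilin N s n k 0 0 * bilin N s n k 1 1)

/-- The basis `1, A⁰, A¹, A², 𝐀²/3` of the spin algebra. -/
def spinBasis (N : ℕ) (s : Species) (n k : ℕ) : Fin 5 → Grassmann :=
  ![1, spinVec N s n k 0, spinVec N s n k 1, spinVec N s n k 2, spinSq N s n k]

theorem spinVec_mem_center (N : ℕ) (s : Species) (n k : ℕ) (j : Fin 3) :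
    spinVec N s n k j ∈ Subalgebra.center ℂ Grassmann :=
  Subalgebra.sum_mem _ fun a _ => Subalgebra.sum_mem _ fun b _ =>
    Subalgebra.smul_mem _ (bilin_mem_center N s n k a b) _

theorem spinSq_mem_center (N : ℕ) (s : Species) (n k : ℕ) :
    spinSq N s n k ∈ Subalgebra.center ℂ Grassmann :=
  Subalgebra.smul_mem _ (mul_mem (bilin_mem_center _ _ _ _ _ _) (bilin_mem_center _ _ _ _ _ _)) _

theorem spinBasis_mem_center (N : ℕ) (s : Species) (n k : ℕ) (p : Fin 5) :
    spinBasis N s n k p ∈ Subalgebra.center ℂ Grassmann := by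
  fin_cases p
  · exact one_mem _
  · exact spinVec_mem_center _ _ _ _ _
  · exact spinVec_mem_center _ _ _ _ _
  · exact spinVec_mem_center _ _ _ _ _
  · exact spinSq_mem_center _ _ _ _

theorem bilin_mem_fieldAlg (N : ℕ) (s : Species) (n k : ℕ) (a b : Fin 2) :
    bilin N s n k a b ∈ fieldAlg (fieldsIn {x | x.species = s ∧ (x.scale = n → x.half = k)}) := by
  rw [bilin, ← ι_lowVec, ← ι_lowVec]
  have h : ∀ p c, lowVec N s p c n k ∈
      fieldsIn {x | x.species = s ∧ (x.scale = n → x.half = k)} := fun p c =>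
    Finsupp.supported_mono (fun x hx => And.intro hx.1 hx.2.2.2) (lowVec_mem N s p c n k)
  exact mul_mem (ι_mem_fieldAlg (h _ _)) (ι_mem_fieldAlg (h _ _))

theorem spinVec_mem_fieldAlg (N : ℕ) (s : Species) (n k : ℕ) (j : Fin 3) :
    spinVec N s n k j ∈ fieldAlg (fieldsIn {x | x.species = s ∧ (x.scale = n → x.half = k)}) :=
  Subalgebra.sum_mem _ fun a _ => Subalgebra.sum_mem _ fun b _ =>
    Subalgebra.smul_mem _ (bilin_mem_fieldAlg N s n k a b) _

theorem spinBasis_mem_fieldAlg (N : ℕ) (s : Species) (n k : ℕ) (p : Fin 5) :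
    spinBasis N s n k p ∈
      fieldAlg (fieldsIn {x | x.species = s ∧ (x.scale = n → x.half = k)}) := by
  fin_cases p
  · exact one_mem _
  · exact spinVec_mem_fieldAlg _ _ _ _ _
  · exact spinVec_mem_fieldAlg _ _ _ _ _
  · exact spinVec_mem_fieldAlg _ _ _ _ _
  · exact Subalgebra.smul_mem _
      (mul_mem (bilin_mem_fieldAlg _ _ _ _ _ _) (bilin_mem_fieldAlg _ _ _ _ _ _)) _

/-- A complete multiplication table for the four bilinears, in a form usable for rewriting: every
product is zero or plus or minus the single quartic monomial. -/
theorem bilin_mul_table (N : ℕ) (s : Species) (n k : ℕ) :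
    (∀ a b c, bilin N s n k a b * bilin N s n k a c = 0) ∧
    (∀ a b c, bilin N s n k a b * bilin N s n k c b = 0) ∧
    bilin N s n k 1 1 * bilin N s n k 0 0 = bilin N s n k 0 0 * bilin N s n k 1 1 ∧
    bilin N s n k 0 1 * bilin N s n k 1 0 = -(bilin N s n k 0 0 * bilin N s n k 1 1) ∧
    bilin N s n k 1 0 * bilin N s n k 0 1 = -(bilin N s n k 0 0 * bilin N s n k 1 1) := by
  refine ⟨bilin_mul_left N s n k, bilin_mul_right N s n k, bilin_comm _ _ _ _ _ _ _, ?_, ?_⟩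
  · exact bilin_exchange N s n k 0 1 1 0
  · rw [bilin_comm]; exact bilin_exchange N s n k 0 1 1 0

theorem bilin_mul_quartic (N : ℕ) (s : Species) (n k : ℕ) (a b : Fin 2) :
    bilin N s n k a b * (bilin N s n k 0 0 * bilin N s n k 1 1) = 0 := by
  fin_cases a
  · change bilin N s n k 0 b * _ = 0
    rw [← mul_assoc, bilin_mul_left, zero_mul]
  · change bilin N s n k 1 b * _ = 0
    rw [bilin_comm _ _ _ _ 0 0, ← mul_assoc, bilin_mul_left, zero_mul]

/-- Unlike Pauli matrices, these components commute, so no antisymmetric term survives; the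
symmetric part is a multiple of the only quartic monomial available. -/
theorem spinVec_mul_spinVec (N : ℕ) (s : Species) (n k : ℕ) (i j : Fin 3) :
    spinVec N s n k i * spinVec N s n k j = if i = j then spinSq N s n k else 0 := by
  obtain ⟨h1, h2, h3, h4, h5⟩ := bilin_mul_table N s n k
  fin_cases i <;> fin_cases j <;>
  simp only [Fin.zero_eta, Fin.mk_one, Fin.reduceFinMk, Fin.isValue, spinVec_zero, spinVec_one,
    spinVec_two, spinSq, mul_add, add_mul, mul_sub, sub_mul, smul_mul_assoc, mul_smul_comm,
    h1, h2, h3, h4, h5, smul_zero, smul_neg, neg_mul, mul_neg, neg_smul, neg_neg, reduceIte, Fin.reduceEq] <;>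
  match_scalars <;> first | ring1 | linear_combination 2 * Complex.I_sq

theorem spinVec_mul_spinSq (N : ℕ) (s : Species) (n k : ℕ) (j : Fin 3) :
    spinVec N s n k j * spinSq N s n k = 0 := by
  have h := bilin_mul_quartic N s n k
  fin_cases j <;>
  simp [spinVec_zero, spinVec_one, spinVec_two, spinSq, add_mul, sub_mul, h]

theorem spinSq_mul_spinSq (N : ℕ) (s : Species) (n k : ℕ) :
    spinSq N s n k * spinSq N s n k = 0 := by
  simp [spinSq, mul_assoc, bilin_mul_quartic]

/-! ### The Wick table of one species -/

/-- Wick's theorem for two pairs without contractions inside a pair, which is the situation of two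
bilinears each living in one half-box. -/
theorem average_four (S : Set ℕ) {u v w z : FieldSpace} (huv : covariance S u v = 0)
    (hwz : covariance S w z = 0) :
    average S (ExteriorAlgebra.ι ℂ u * ExteriorAlgebra.ι ℂ v *
      (ExteriorAlgebra.ι ℂ w * ExteriorAlgebra.ι ℂ z)) =
    ExteriorAlgebra.ι ℂ (dropFields S u) * ExteriorAlgebra.ι ℂ (dropFields S v) *
      (ExteriorAlgebra.ι ℂ (dropFields S w) * ExteriorAlgebra.ι ℂ (dropFields S z)) +
    covariance S v w • (ExteriorAlgebra.ι ℂ (dropFields S u) *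
      ExteriorAlgebra.ι ℂ (dropFields S z)) -
    covariance S v z • (ExteriorAlgebra.ι ℂ (dropFields S u) *
      ExteriorAlgebra.ι ℂ (dropFields S w)) -
    covariance S u w • (ExteriorAlgebra.ι ℂ (dropFields S v) *
      ExteriorAlgebra.ι ℂ (dropFields S z)) +
    covariance S u z • (ExteriorAlgebra.ι ℂ (dropFields S v) *
      ExteriorAlgebra.ι ℂ (dropFields S w)) +
    (covariance S u z * covariance S v w - covariance S u w * covariance S v z) • 1 := by
  have hc : ∀ d x, contractLeft d (ExteriorAlgebra.ι ℂ x) = algebraMap ℂ Grassmann (d x) :=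
    fun d x => CliffordAlgebra.contractLeft_ι _ _ _
  simp only [mul_assoc, average_ι_mul, contractLeft_ι_mul', hc, huv, hwz, zero_smul, zero_sub,
    map_neg, map_sub, map_smul, average_ι, map_zero, add_zero,
    Algebra.algebraMap_eq_smul_one, mul_sub, mul_smul_comm, mul_one, mul_add, average_one]
  module

theorem average_two (S : Set ℕ) {u v : FieldSpace} (huv : covariance S u v = 0) :
    average S (ExteriorAlgebra.ι ℂ u * ExteriorAlgebra.ι ℂ v) =
    ExteriorAlgebra.ι ℂ (dropFields S u) * ExteriorAlgebra.ι ℂ (dropFields S v) := by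
  have hc : ∀ d x, contractLeft d (ExteriorAlgebra.ι ℂ x) = algebraMap ℂ Grassmann (d x) :=
    fun d x => CliffordAlgebra.contractLeft_ι _ _ _
  simp only [average_ι_mul, hc, huv, average_ι, map_zero, add_zero]

theorem average_three (S : Set ℕ) {u v w : FieldSpace} (huv : covariance S u v = 0) :
    average S (ExteriorAlgebra.ι ℂ u * ExteriorAlgebra.ι ℂ v * ExteriorAlgebra.ι ℂ w) =
    ExteriorAlgebra.ι ℂ (dropFields S u) * ExteriorAlgebra.ι ℂ (dropFields S v) *
      ExteriorAlgebra.ι ℂ (dropFields S w) +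
    covariance S v w • ExteriorAlgebra.ι ℂ (dropFields S u) -
    covariance S u w • ExteriorAlgebra.ι ℂ (dropFields S v) := by
  have hc : ∀ d x, contractLeft d (ExteriorAlgebra.ι ℂ x) = algebraMap ℂ Grassmann (d x) :=
    fun d x => CliffordAlgebra.contractLeft_ι _ _ _
  simp only [mul_assoc, average_ι_mul, contractLeft_ι_mul', hc, huv, zero_smul, zero_sub,
    map_neg, map_smul, average_ι,
    Algebra.algebraMap_eq_smul_one, mul_smul_comm, mul_one, mul_add, average_one]
  module

theorem average_three' (S : Set ℕ) {u v w : FieldSpace} (hvw : covariance S v w = 0) :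
    average S (ExteriorAlgebra.ι ℂ u * (ExteriorAlgebra.ι ℂ v * ExteriorAlgebra.ι ℂ w)) =
    ExteriorAlgebra.ι ℂ (dropFields S u) * (ExteriorAlgebra.ι ℂ (dropFields S v) *
      ExteriorAlgebra.ι ℂ (dropFields S w)) +
    covariance S u v • ExteriorAlgebra.ι ℂ (dropFields S w) -
    covariance S u w • ExteriorAlgebra.ι ℂ (dropFields S v) := by
  have hc : ∀ d x, contractLeft d (ExteriorAlgebra.ι ℂ x) = algebraMap ℂ Grassmann (d x) :=
    fun d x => CliffordAlgebra.contractLeft_ι _ _ _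
  simp only [average_ι_mul, contractLeft_ι_mul', hc, hvw,
    map_sub, map_smul, average_ι, map_zero, add_zero,
    Algebra.algebraMap_eq_smul_one, mul_smul_comm, mul_one]
  module

theorem propagator_same_half (s : Species) (p p' : Bool) (a a' : Fin 2) (n k : ℕ) :
    propagator ⟨s, p, a, n, k⟩ ⟨s, p', a', n, k⟩ = 0 := by
  simp [propagator]

/-- With the lower half on the left, both orders of the superscripts give `+1`: in one of them `η =
-1` is compensated by the sign of `⟨y⁺ x⁻⟩ = -⟨x⁻ y⁺⟩`. -/
theorem propagator_halves (s : Species) (p p' : Bool) (a a' : Fin 2) (n i : ℕ) :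
    propagator ⟨s, p, a, n, 2 * i⟩ ⟨s, p', a', n, 2 * i + 1⟩ =
      if a = a' ∧ p ≠ p' then 1 else 0 := by
  have h1 : 2 * i / 2 = i := by omega
  have h2 : (2 * i + 1) / 2 = i := by omega
  have h3 : (2 * i + 1) % 2 = 1 := by omega
  cases p <;> cases p' <;> simp [propagator, eta, h1, h2, h3]

/-- After averaging, the two half-boxes see the same field of the next scale, so the uncontracted
product of three fields of one spin repeats a field and vanishes. -/
theorem lowField_triple (N : ℕ) (s : Species) (p : Bool) (n k : ℕ) (c : Fin 2) :
    lowField N s true c n k * lowField N s false c n k * lowField N s p c n k = 0 := by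
  cases p
  · rw [mul_assoc, lowField_sq, mul_zero]
  · rw [lowField_swap N s n k true false, neg_mul, mul_assoc, lowField_sq, mul_zero, neg_zero]

theorem lowField_triple' (N : ℕ) (s : Species) (p : Bool) (n k : ℕ) (c : Fin 2) :
    lowField N s p c n k * (lowField N s true c n k * lowField N s false c n k) = 0 := by
  cases p
  · rw [lowField_swap N s n k true false, mul_neg, ← mul_assoc, lowField_sq, zero_mul, neg_zero]
  · rw [← mul_assoc, lowField_sq, zero_mul]

theorem average_bilin {N n : ℕ} (h : n ≤ N) (s : Species) (k : ℕ) (a b : Fin 2) :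
    average {n} (bilin N s n k a b) = scaling s ^ 2 • bilin N s (n + 1) (k / 2) a b := by
  rw [bilin, ← ι_lowVec, ← ι_lowVec, average_two, dropFields_lowVec N _ _ _ _ _ h,
    dropFields_lowVec N _ _ _ _ _ h, map_smul, map_smul, ι_lowVec, ι_lowVec, smul_mul_smul_comm,
    ← pow_two, bilin]
  rw [covariance_lowVec N _ _ _ _ _ _ _ _ _ h, propagator_same_half]

theorem average_bilin_mul_bilin {N n : ℕ} (h : n ≤ N) (s : Species) (i : ℕ) (a b c d : Fin 2) :
    average {n} (bilin N s n (2 * i) a b * bilin N s n (2 * i + 1) c d) =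
      scaling s ^ 4 • (bilin N s (n + 1) i a b * bilin N s (n + 1) i c d) +
      (if b = c then scaling s ^ 2 else 0) • bilin N s (n + 1) i a d -
      (if a = d then scaling s ^ 2 else 0) • bilin N s (n + 1) i c b +
      (if b = c ∧ a = d then (1 : ℂ) else 0) • 1 := by
  have h1 : 2 * i / 2 = i := by omega
  have h2 : (2 * i + 1) / 2 = i := by omega
  rw [bilin, bilin, ← ι_lowVec, ← ι_lowVec, ← ι_lowVec, ← ι_lowVec, average_four]
  · simp only [dropFields_lowVec N _ _ _ _ _ h, covariance_lowVec N _ _ _ _ _ _ _ _ _ h,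
      propagator_halves, map_smul, ι_lowVec, h1, h2, smul_mul_smul_comm, bilin]
    -- Contracting the two outer fields leaves `ψ⁻ψ⁺`; restoring the order produces the minus sign
    -- of the third term.
    rw [lowField_swap N s (n + 1) i false true]
    by_cases hb : b = c <;> by_cases ha : a = d <;> simp [hb, ha] <;> module
  · rw [covariance_lowVec N _ _ _ _ _ _ _ _ _ h, propagator_same_half]
  · rw [covariance_lowVec N _ _ _ _ _ _ _ _ _ h, propagator_same_half]

/-- An odd element. Such averages are needed because sorting an off-diagonal bilinear by spin splits
it into two odd factors. -/
theorem average_lowField_three {N n : ℕ} (h : n ≤ N) (s : Species) (i : ℕ) (c : Fin 2) (p : Bool) :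
    average {n} (bilin N s n (2 * i) c c * lowField N s p c n (2 * i + 1)) =
      (if p then scaling s else -scaling s) • lowField N s p c (n + 1) i := by
  have h1 : 2 * i / 2 = i := by omega
  have h2 : (2 * i + 1) / 2 = i := by omega
  rw [bilin, ← ι_lowVec, ← ι_lowVec, ← ι_lowVec, average_three]
  · simp only [dropFields_lowVec N _ _ _ _ _ h, covariance_lowVec N _ _ _ _ _ _ _ _ _ h,
      propagator_halves, map_smul, ι_lowVec, h1, h2, smul_mul_smul_comm]
    cases p <;> simp [lowField_triple]
  · rw [covariance_lowVec N _ _ _ _ _ _ _ _ _ h, propagator_same_half]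

theorem average_lowField_three' {N n : ℕ} (h : n ≤ N) (s : Species) (i : ℕ) (c : Fin 2) (p : Bool) :
    average {n} (lowField N s p c n (2 * i) * bilin N s n (2 * i + 1) c c) =
      (if p then -scaling s else scaling s) • lowField N s p c (n + 1) i := by
  have h1 : 2 * i / 2 = i := by omega
  have h2 : (2 * i + 1) / 2 = i := by omega
  rw [bilin, ← ι_lowVec, ← ι_lowVec, ← ι_lowVec, average_three']
  · simp only [dropFields_lowVec N _ _ _ _ _ h, covariance_lowVec N _ _ _ _ _ _ _ _ _ h,
      propagator_halves, map_smul, ι_lowVec, h1, h2, smul_mul_smul_comm]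
    cases p <;> simp [lowField_triple']
  · rw [covariance_lowVec N _ _ _ _ _ _ _ _ _ h, propagator_same_half]

/-! ### Factorization over spins and averages of quartic monomials. -/

theorem lowField_mem_spin (s : Species) (N : ℕ) (p : Bool) (a : Fin 2) (n k : ℕ) :
    lowField N s p a n k ∈ fieldAlg (fieldsIn {x | x.spin = a}) := by
  rw [← ι_lowVec]
  exact ι_mem_fieldAlg (Finsupp.supported_mono (fun x hx => hx.2.1) (lowVec_mem N s p a n k))

theorem bilin_mem_spin (s : Species) (N : ℕ) (a : Fin 2) (n k : ℕ) :
    bilin N s n k a a ∈ fieldAlg (fieldsIn {x | x.spin = a}) :=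
  mul_mem (lowField_mem_spin s N true a n k) (lowField_mem_spin s N false a n k)

/-- The covariance is diagonal in the spin. Averages of up to eight fields thereby reduce to those
with at most two fields of one spin in each half-box. -/
theorem average_mul_of_spin (S : Set ℕ) {a b : Fin 2} (hab : a ≠ b) {x y : Grassmann}
    (hx : x ∈ fieldAlg (fieldsIn {x | x.spin = a}))
    (hy : y ∈ fieldAlg (fieldsIn {x | x.spin = b})) :
    average S (x * y) = average S x * average S y := by
  refine average_mul_of_orthogonal S (covariance_eq_zero ?_) hx hy
  intro x hx y hy _ _
  have : x.spin ≠ y.spin := by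
    rw [Set.mem_ofPred_eq] at hx hy
    rwa [hx, hy]
  simp [propagator, this]

theorem average_bilin_diag {N n : ℕ} (h : n ≤ N) (s : Species) (i : ℕ) (a : Fin 2) :
    average {n} (bilin N s n (2 * i) a a * bilin N s n (2 * i + 1) a a) = 1 := by
  rw [average_bilin_mul_bilin h]
  simp [bilin_mul_left]

theorem average_quartic {N n : ℕ} (h : n ≤ N) (s : Species) (k : ℕ) :
    average {n} (bilin N s n k 0 0 * bilin N s n k 1 1) =
      scaling s ^ 4 • (bilin N s (n + 1) (k / 2) 0 0 * bilin N s (n + 1) (k / 2) 1 1) := by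
  rw [average_mul_of_spin _ (by decide) (bilin_mem_spin s N 0 n k) (bilin_mem_spin s N 1 n k),
    average_bilin h, average_bilin h, smul_mul_smul_comm]
  congr 1; ring

theorem average_quartic_mul_quartic {N n : ℕ} (h : n ≤ N) (s : Species) (i : ℕ) :
    average {n} (bilin N s n (2 * i) 0 0 * bilin N s n (2 * i) 1 1 *
      (bilin N s n (2 * i + 1) 0 0 * bilin N s n (2 * i + 1) 1 1)) = 1 := by
  rw [mul_assoc, bilin_comm N s n (2 * i) 1 1, mul_assoc, ← mul_assoc,
    ← bilin_comm N s n (2 * i) 1 1,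
    average_mul_of_spin _ (by decide : (0 : Fin 2) ≠ 1)
      (mul_mem (bilin_mem_spin s N 0 n _) (bilin_mem_spin s N 0 n _))
      (mul_mem (bilin_mem_spin s N 1 n _) (bilin_mem_spin s N 1 n _)),
    average_bilin_diag h, average_bilin_diag h, one_mul]

/-- Sorted by spin, the product splits into one three-field average for each spin. These carry
opposite signs, whence the overall minus. -/
theorem average_quartic_mul_offdiag {N n : ℕ} (h : n ≤ N) (s : Species) (i : ℕ)
    {c d : Fin 2} (hcd : c ≠ d) :
    average {n} (bilin N s n (2 * i) c c * bilin N s n (2 * i) d d *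
      bilin N s n (2 * i + 1) c d) = -(scaling s ^ 2 • bilin N s (n + 1) i c d) := by
  have : bilin N s n (2 * i) c c * bilin N s n (2 * i) d d * bilin N s n (2 * i + 1) c d =
      (bilin N s n (2 * i) c c * lowField N s true c n (2 * i + 1)) *
        (bilin N s n (2 * i) d d * lowField N s false d n (2 * i + 1)) := by
    rw [bilin_comm N s n (2 * i) d d (lowField N s false d n (2 * i + 1)), mul_assoc, mul_assoc,
      bilin_comm N s n (2 * i) d d, ← mul_assoc (lowField N s true c n (2 * i + 1))]
    rfl
  rw [this, average_mul_of_spin _ hcd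
      (mul_mem (bilin_mem_spin s N c n _) (lowField_mem_spin s N _ c n _))
      (mul_mem (bilin_mem_spin s N d n _) (lowField_mem_spin s N _ d n _)),
    average_lowField_three h, average_lowField_three h, smul_mul_smul_comm, bilin]
  simp; ring_nf

theorem average_offdiag_mul_quartic {N n : ℕ} (h : n ≤ N) (s : Species) (i : ℕ)
    {c d : Fin 2} (hcd : c ≠ d) :
    average {n} (bilin N s n (2 * i) c d *
      (bilin N s n (2 * i + 1) c c * bilin N s n (2 * i + 1) d d)) =
        -(scaling s ^ 2 • bilin N s (n + 1) i c d) := by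
  have : bilin N s n (2 * i) c d * (bilin N s n (2 * i + 1) c c * bilin N s n (2 * i + 1) d d) =
      (lowField N s true c n (2 * i) * bilin N s n (2 * i + 1) c c) *
        (lowField N s false d n (2 * i) * bilin N s n (2 * i + 1) d d) := by
    rw [bilin_comm N s n (2 * i + 1) c c (bilin N s n (2 * i + 1) d d),
      mul_assoc (lowField N s true c n (2 * i)) (bilin N s n (2 * i + 1) c c),
      bilin_comm N s n (2 * i + 1) c c (lowField N s false d n (2 * i) * _),
      show bilin N s n (2 * i) c d = lowField N s true c n (2 * i) * lowField N s false d n (2 * i)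
        from rfl, mul_assoc, mul_assoc]
  rw [this, average_mul_of_spin _ hcd
      (mul_mem (lowField_mem_spin s N _ c n _) (bilin_mem_spin s N c n _))
      (mul_mem (lowField_mem_spin s N _ d n _) (bilin_mem_spin s N d n _)),
    average_lowField_three' h, average_lowField_three' h, smul_mul_smul_comm, bilin]
  simp; ring_nf

/-- The averages form the adjugate, trace minus matrix, of the matrix of bilinears. On the traceless
combinations defining the spin this is a change of sign, which together with the `-2` in `spinSq`
gives the coefficient `2 * scaling s ^ 2` of `average_spinSq_mul_spinVec`. -/
theorem average_quartic_mul_bilin {N n : ℕ} (h : n ≤ N) (s : Species) (i : ℕ) (c d : Fin 2) :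
    average {n} (bilin N s n (2 * i) 0 0 * bilin N s n (2 * i) 1 1 *
      bilin N s n (2 * i + 1) c d) =
      (if c = d then scaling s ^ 2 else 0) • (bilin N s (n + 1) i 0 0 + bilin N s (n + 1) i 1 1) -
        scaling s ^ 2 • bilin N s (n + 1) i c d := by
  have h1 : 2 * i / 2 = i := by omega
  fin_cases c <;> fin_cases d <;> simp only [Fin.zero_eta, Fin.mk_one, Fin.isValue, reduceIte,
    Fin.reduceEq]
  · rw [mul_assoc, bilin_comm N s n (2 * i) 1 1, ← mul_assoc,
      average_mul_of_spin _ (by decide : (0 : Fin 2) ≠ 1)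
        (mul_mem (bilin_mem_spin s N 0 n _) (bilin_mem_spin s N 0 n _)) (bilin_mem_spin s N 1 n _),
      average_bilin_diag h, average_bilin h, one_mul, h1]
    module
  · rw [average_quartic_mul_offdiag h s i (by decide)]
    module
  · rw [bilin_comm N s n (2 * i) 0 0, average_quartic_mul_offdiag h s i (by decide)]
    module
  · rw [mul_assoc, average_mul_of_spin _ (by decide : (0 : Fin 2) ≠ 1) (bilin_mem_spin s N 0 n _)
        (mul_mem (bilin_mem_spin s N 1 n _) (bilin_mem_spin s N 1 n _)),
      average_bilin_diag h, average_bilin h, mul_one, h1]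
    module

theorem average_bilin_mul_quartic {N n : ℕ} (h : n ≤ N) (s : Species) (i : ℕ) (c d : Fin 2) :
    average {n} (bilin N s n (2 * i) c d *
      (bilin N s n (2 * i + 1) 0 0 * bilin N s n (2 * i + 1) 1 1)) =
      (if c = d then scaling s ^ 2 else 0) • (bilin N s (n + 1) i 0 0 + bilin N s (n + 1) i 1 1) -
        scaling s ^ 2 • bilin N s (n + 1) i c d := by
  have h1 : (2 * i + 1) / 2 = i := by omega
  fin_cases c <;> fin_cases d <;> simp only [Fin.zero_eta, Fin.mk_one, Fin.isValue, reduceIte,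
    Fin.reduceEq]
  · rw [← mul_assoc,
      average_mul_of_spin _ (by decide : (0 : Fin 2) ≠ 1)
        (mul_mem (bilin_mem_spin s N 0 n _) (bilin_mem_spin s N 0 n _)) (bilin_mem_spin s N 1 n _),
      average_bilin_diag h, average_bilin h, one_mul, h1]
    module
  · rw [average_offdiag_mul_quartic h s i (by decide)]
    module
  · rw [bilin_comm N s n (2 * i + 1) 0 0, average_offdiag_mul_quartic h s i (by decide)]
    module
  · rw [← mul_assoc, bilin_comm N s n (2 * i) 1 1, mul_assoc,
      average_mul_of_spin _ (by decide : (0 : Fin 2) ≠ 1) (bilin_mem_spin s N 0 n _)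
        (mul_mem (bilin_mem_spin s N 1 n _) (bilin_mem_spin s N 1 n _)),
      average_bilin_diag h, average_bilin h, mul_one, h1]
    module

/-! ### Averages of products of spins from the two halves of a box. -/

theorem average_spinVec {N n : ℕ} (h : n ≤ N) (s : Species) (k : ℕ) (j : Fin 3) :
    average {n} (spinVec N s n k j) = scaling s ^ 2 • spinVec N s (n + 1) (k / 2) j := by
  have : ∀ m l, spinVec N s m l j = ∑ a : Fin 2, ∑ b : Fin 2, pauli j a b • bilin N s m l a b :=
    fun _ _ => rfl
  simp only [this, map_sum, map_smul, average_bilin h, Finset.smul_sum, smul_comm (scaling s ^ 2)]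

theorem average_spinSq {N n : ℕ} (h : n ≤ N) (s : Species) (k : ℕ) :
    average {n} (spinSq N s n k) = scaling s ^ 4 • spinSq N s (n + 1) (k / 2) := by
  rw [spinSq, map_smul, average_quartic h, smul_comm, spinSq]

theorem average_spinSq_mul_spinSq {N n : ℕ} (h : n ≤ N) (s : Species) (i : ℕ) :
    average {n} (spinSq N s n (2 * i) * spinSq N s n (2 * i + 1)) = (4 : ℂ) • 1 := by
  rw [spinSq, spinSq, smul_mul_smul_comm, map_smul, average_quartic_mul_quartic h]
  norm_num

theorem average_spinSq_mul_spinVec {N n : ℕ} (h : n ≤ N) (s : Species) (i : ℕ) (j : Fin 3) :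
    average {n} (spinSq N s n (2 * i) * spinVec N s n (2 * i + 1) j) =
      (2 * scaling s ^ 2) • spinVec N s (n + 1) i j := by
  fin_cases j <;>
  simp only [Fin.zero_eta, Fin.mk_one, Fin.reduceFinMk, Fin.isValue, spinVec_zero, spinVec_one,
    spinVec_two, spinSq, mul_add, mul_sub, smul_mul_assoc, mul_smul_comm, map_add, map_sub,
    map_smul, average_quartic_mul_bilin h, reduceIte, Fin.reduceEq] <;>
  module

theorem average_spinVec_mul_spinSq {N n : ℕ} (h : n ≤ N) (s : Species) (i : ℕ) (j : Fin 3) :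
    average {n} (spinVec N s n (2 * i) j * spinSq N s n (2 * i + 1)) =
      (2 * scaling s ^ 2) • spinVec N s (n + 1) i j := by
  fin_cases j <;>
  simp only [Fin.zero_eta, Fin.mk_one, Fin.reduceFinMk, Fin.isValue, spinVec_zero, spinVec_one,
    spinVec_two, spinSq, add_mul, sub_mul, smul_mul_assoc, mul_smul_comm, map_add, map_sub,
    map_smul, average_bilin_mul_quartic h, reduceIte, Fin.reduceEq] <;>
  module

/-- The double contraction gives `tr (σ^j σ^j) = 2`, the single contractions combine into the
commutator `[σ^j, σ^j] = 0`, and the uncontracted term is the square of a spin component on the next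
scale. -/
theorem average_spinVec_mul_self {N n : ℕ} (h : n ≤ N) (s : Species) (i : ℕ) (j : Fin 3) :
    average {n} (spinVec N s n (2 * i) j * spinVec N s n (2 * i + 1) j) =
      (2 : ℂ) • 1 + scaling s ^ 4 • spinSq N s (n + 1) i := by
  obtain ⟨h1, h2, h3, h4, h5⟩ := bilin_mul_table N s (n + 1) i
  fin_cases j <;>
  simp only [Fin.zero_eta, Fin.mk_one, Fin.reduceFinMk, Fin.isValue, spinVec_zero, spinVec_one,
    spinVec_two, spinSq, add_mul, mul_add, sub_mul, mul_sub, smul_mul_assoc, mul_smul_comm, map_add,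
    map_sub, map_smul, average_bilin_mul_bilin h, reduceIte, Fin.reduceEq, h1, h2, h3, h4, h5,
    and_self, and_true, and_false, true_and, false_and] <;>
  match_scalars <;> first
    | ring1
    | linear_combination (-2 : ℂ) * Complex.I_sq
    | linear_combination (2 * scaling s ^ 4) * Complex.I_sq

/-- For different components the trace and the uncontracted term vanish, and the single contractions
give `ψ⁺[σ^j, σ^l]ψ⁻ = 2i ψ⁺σ^mψ⁻` for a cyclic triple. -/
theorem average_spinVec_mul_spinVec {N n : ℕ} (h : n ≤ N) (s : Species) (i : ℕ)
    {j l m : Fin 3}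
    (hjl : (j, l, m) = (0, 1, 2) ∨ (j, l, m) = (1, 2, 0) ∨ (j, l, m) = (2, 0, 1)) :
    average {n} (spinVec N s n (2 * i) j * spinVec N s n (2 * i + 1) l) =
      (2 * Complex.I * scaling s ^ 2) • spinVec N s (n + 1) i m ∧
    average {n} (spinVec N s n (2 * i) l * spinVec N s n (2 * i + 1) j) =
      (-(2 * Complex.I * scaling s ^ 2)) • spinVec N s (n + 1) i m := by
  obtain ⟨h1, h2, h3, h4, h5⟩ := bilin_mul_table N s (n + 1) i
  rcases hjl with hj | hj | hj <;>
  · simp only [Prod.mk.injEq] at hj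
    obtain ⟨rfl, rfl, rfl⟩ := hj
    constructor <;>
    simp only [Fin.isValue, spinVec_zero, spinVec_one,
      spinVec_two, add_mul, mul_add, sub_mul, mul_sub, smul_mul_assoc, mul_smul_comm,
      map_add, map_sub, map_smul, average_bilin_mul_bilin h, reduceIte, Fin.reduceEq, h1, h2, h3,
      h4, h5, and_self, and_true, and_false, true_and, false_and] <;>
    match_scalars <;> first
      | ring1
      | linear_combination (2 * scaling s ^ 2) * Complex.I_sq
      | linear_combination (-2 * scaling s ^ 2) * Complex.I_sq

/-! ### The algebra of the two spins -/

theorem spinSq_mul_comm (N : ℕ) (s : Species) (n k : ℕ) (x : Grassmann) :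
    spinSq N s n k * x = x * spinSq N s n k :=
  (Subalgebra.mem_center_iff.1 (spinSq_mem_center N s n k) x).symm

theorem spinBasis_mul_comm (N : ℕ) (s : Species) (n k : ℕ) (p : Fin 5) (x : Grassmann) :
    spinBasis N s n k p * x = x * spinBasis N s n k p :=
  (Subalgebra.mem_center_iff.1 (spinBasis_mem_center N s n k p) x).symm

/-- The linear combination of the products of two families with a matrix of coefficients. -/
def pairComb (e f : Fin 5 → Grassmann) (X : Matrix (Fin 5) (Fin 5) ℂ) : Grassmann :=
  ∑ p, ∑ q, X p q • (e p * f q)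

theorem pairComb_smul (e f : Fin 5 → Grassmann) (c : ℂ) (X : Matrix (Fin 5) (Fin 5) ℂ) :
    pairComb e f (c • X) = c • pairComb e f X := by
  simp [pairComb, Finset.smul_sum, smul_smul]

/-- One statement serves for multiplication (`Φ` the identity) and for averaging, since both act on
each species separately through a table. The nested sums allow the two tables to be evaluated one
after the other. -/
theorem map_pairComb (Φ : Grassmann →ₗ[ℂ] Grassmann) {e f e₂ f₂ e₃ f₃ : Fin 5 → Grassmann}
    {τ τ' : Fin 5 → Matrix (Fin 5) (Fin 5) ℂ}
    (h : ∀ p q p' q', Φ ((e p * f q) * (e₂ p' * f₂ q')) =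
      (∑ r, τ r p p' • e₃ r) * (∑ r, τ' r q q' • f₃ r)) (X Y : Matrix (Fin 5) (Fin 5) ℂ) :
    Φ (pairComb e f X * pairComb e₂ f₂ Y) = pairComb e₃ f₃ fun r r' =>
      ∑ p, ∑ p', (∑ q, ∑ q', (X p q * Y p' q') * τ' r' q q') * τ r p p' := by
  have hl : Φ (pairComb e f X * pairComb e₂ f₂ Y) =
      ∑ p', ∑ q', ∑ p, ∑ q, ∑ r, ∑ r', ((X p q * Y p' q') * τ' r' q q' * τ r p p') •
        (e₃ r * f₃ r') := by
    simp only [pairComb, Finset.sum_mul_sum, Finset.sum_mul, Finset.mul_sum, map_sum,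
      smul_mul_smul_comm, map_smul, h, Finset.smul_sum, smul_smul]
    refine Finset.sum_congr rfl fun p' _ => Finset.sum_congr rfl fun q' _ =>
      Finset.sum_congr rfl fun p _ => Finset.sum_congr rfl fun q _ => ?_
    rw [Finset.sum_comm]
    refine Finset.sum_congr rfl fun r _ => Finset.sum_congr rfl fun r' _ => ?_
    congr 1; ring
  rw [hl]
  simp only [pairComb, Finset.sum_mul, Finset.sum_smul]
  simp only [← Fintype.sum_prod_type']
  exact Fintype.sum_equiv
    ⟨fun ⟨p', q', p, q, r, r'⟩ => ⟨r, r', p, p', q, q'⟩,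
      fun ⟨r, r', p, p', q, q'⟩ => ⟨p', q', p, q, r, r'⟩,
      fun _ => rfl, fun _ => rfl⟩ _ _ (by rintro ⟨p', q', p, q, r, r'⟩; rfl)

/-- The coefficients on the products of spins of `c + ∑ l_p O_p`. -/
def coef (c : ℂ) (l : Fin 9 → ℂ) (w : Fin 3 → ℂ) : Matrix (Fin 5) (Fin 5) ℂ :=
  !![c, l 5 / 2 * w 0, l 5 / 2 * w 1, l 5 / 2 * w 2, 3 / 2 * l 2;
    l 4 / 2 * w 0, l 0 / 2 + l 6 / 2 * (w 0 * w 0), l 6 / 2 * (w 0 * w 1), l 6 / 2 * (w 0 * w 2),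
      3 / 2 * l 8 * w 0;
    l 4 / 2 * w 1, l 6 / 2 * (w 1 * w 0), l 0 / 2 + l 6 / 2 * (w 1 * w 1), l 6 / 2 * (w 1 * w 2),
      3 / 2 * l 8 * w 1;
    l 4 / 2 * w 2, l 6 / 2 * (w 2 * w 0), l 6 / 2 * (w 2 * w 1), l 0 / 2 + l 6 / 2 * (w 2 * w 2),
      3 / 2 * l 8 * w 2;
    3 / 2 * l 1, 3 / 2 * l 7 * w 0, 3 / 2 * l 7 * w 1, 3 / 2 * l 7 * w 2, 9 / 2 * l 3]

theorem smul_coef (a c : ℂ) (l : Fin 9 → ℂ) (w : Fin 3 → ℂ) :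
    a • coef c l w = coef (a * c) (a • l) w := by
  ext i j
  fin_cases i <;> fin_cases j <;> simp [coef] <;> ring

/-- The products of the spins at a half-box. -/
def spinComb (N n k : ℕ) (X : Matrix (Fin 5) (Fin 5) ℂ) : Grassmann :=
  pairComb (spinBasis N .electron n k) (spinBasis N .impurity n k) X

theorem dotG_self (N : ℕ) (s : Species) (n k : ℕ) :
    dotG (spinVec N s n k) (spinVec N s n k) = (3 : ℂ) • spinSq N s n k := by
  simp only [dotG, spinVec_mul_spinVec, reduceIte, Fin.sum_univ_three]
  module

/-- Passage from the nine operators to the coefficient matrix. The factors `3/2` and `9/2` come from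
`𝐀² = 3 S`; the free constant `c` covers both `1 + ∑ ℓ_n O_n` and the bare sum. -/
theorem smul_one_add_opComb (dir : EuclideanSpace ℝ (Fin 3)) (N n k : ℕ) (c : ℂ)
    (l : Fin 9 → ℝ) :
    c • 1 + opComb dir N n k l =
      spinComb N n k (coef c (fun p => (l p : ℂ)) fun j => (dir j : ℂ)) := by
  have h9 : ∀ f : Fin 9 → Grassmann, ∑ p, f p =
      f 0 + f 1 + f 2 + f 3 + f 4 + f 5 + f 6 + f 7 + f 8 := fun f => by
    simp [Fin.sum_univ_succ]; abel
  have o0 : op dir N n k 0 = (1 / 2 : ℂ) • (spinVec N .electron n k 0 * spinVec N .impurity n k 0 +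
      spinVec N .electron n k 1 * spinVec N .impurity n k 1 +
      spinVec N .electron n k 2 * spinVec N .impurity n k 2) := by
    rw [← Fin.sum_univ_three fun j => spinVec N .electron n k j * spinVec N .impurity n k j]; rfl
  have o1 : op dir N n k 1 = (3 / 2 : ℂ) • spinSq N .electron n k := by
    change (1 / 2 : ℂ) • dotG _ _ = _
    rw [dotG_self]; module
  have o2 : op dir N n k 2 = (3 / 2 : ℂ) • spinSq N .impurity n k := by
    change (1 / 2 : ℂ) • dotG _ _ = _
    rw [dotG_self]; module
  have o3 : op dir N n k 3 = (9 / 2 : ℂ) • (spinSq N .electron n k * spinSq N .impurity n k) := by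
    change (1 / 2 : ℂ) • (dotG _ _ * dotG _ _) = _
    rw [dotG_self, dotG_self, smul_mul_smul_comm]; module
  have hR : ∀ s, dotR (spinVec N s n k) dir = (dir 0 : ℂ) • spinVec N s n k 0 +
      (dir 1 : ℂ) • spinVec N s n k 1 + (dir 2 : ℂ) • spinVec N s n k 2 := fun s => by
    rw [dotR, Fin.sum_univ_three]
  have o4 : op dir N n k 4 = (1 / 2 : ℂ) • dotR (spinVec N .electron n k) dir := rfl
  have o5 : op dir N n k 5 = (1 / 2 : ℂ) • dotR (spinVec N .impurity n k) dir := rfl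
  have o6 : op dir N n k 6 = (1 / 2 : ℂ) • (dotR (spinVec N .electron n k) dir *
    dotR (spinVec N .impurity n k) dir) := rfl
  have o7 : op dir N n k 7 = (3 / 2 : ℂ) • (spinSq N .electron n k *
      dotR (spinVec N .impurity n k) dir) := by
    change (1 / 2 : ℂ) • (dotG _ _ * _) = _
    rw [dotG_self, smul_mul_assoc]; module
  have o8 : op dir N n k 8 = (3 / 2 : ℂ) • (dotR (spinVec N .electron n k) dir *
      spinSq N .impurity n k) := by
    change (1 / 2 : ℂ) • (dotG _ _ * _) = _
    rw [dotG_self, smul_mul_assoc, spinSq_mul_comm]; module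
  rw [opComb, h9, o0, o1, o2, o3, o4, o5, o6, o7, o8, hR, hR]
  simp only [spinComb, pairComb, Fin.sum_univ_five, spinBasis, coef, Matrix.of_apply,
    Matrix.cons_val, Matrix.cons_val_zero, Matrix.cons_val_one, one_mul, mul_one, mul_add, add_mul,
    smul_mul_assoc, mul_smul_comm]
  module

/-- The coefficients of the averages of the products of the spins of the two halves of a box. -/
def wick (κ : ℂ) : Fin 5 → Matrix (Fin 5) (Fin 5) ℂ :=
  ![!![1, 0, 0, 0, 0; 0, 2, 0, 0, 0; 0, 0, 2, 0, 0; 0, 0, 0, 2, 0; 0, 0, 0, 0, 4],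
    !![0, κ, 0, 0, 0; κ, 0, 0, 0, 2 * κ; 0, 0, 0, 2 * Complex.I * κ, 0;
      0, 0, -(2 * Complex.I * κ), 0, 0; 0, 2 * κ, 0, 0, 0],
    !![0, 0, κ, 0, 0; 0, 0, 0, -(2 * Complex.I * κ), 0; κ, 0, 0, 0, 2 * κ;
      0, 2 * Complex.I * κ, 0, 0, 0; 0, 0, 2 * κ, 0, 0],
    !![0, 0, 0, κ, 0; 0, 0, 2 * Complex.I * κ, 0, 0; 0, -(2 * Complex.I * κ), 0, 0, 0;
      κ, 0, 0, 0, 2 * κ; 0, 0, 0, 2 * κ, 0],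
    !![0, 0, 0, 0, κ ^ 2; 0, κ ^ 2, 0, 0, 0; 0, 0, κ ^ 2, 0, 0; 0, 0, 0, κ ^ 2, 0;
      κ ^ 2, 0, 0, 0, 0]]

/-- The structure constants of the spin algebra. -/
def spinTable : Fin 5 → Matrix (Fin 5) (Fin 5) ℂ :=
  ![!![1, 0, 0, 0, 0; 0, 0, 0, 0, 0; 0, 0, 0, 0, 0; 0, 0, 0, 0, 0; 0, 0, 0, 0, 0],
    !![0, 1, 0, 0, 0; 1, 0, 0, 0, 0; 0, 0, 0, 0, 0; 0, 0, 0, 0, 0; 0, 0, 0, 0, 0],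
    !![0, 0, 1, 0, 0; 0, 0, 0, 0, 0; 1, 0, 0, 0, 0; 0, 0, 0, 0, 0; 0, 0, 0, 0, 0],
    !![0, 0, 0, 1, 0; 0, 0, 0, 0, 0; 0, 0, 0, 0, 0; 1, 0, 0, 0, 0; 0, 0, 0, 0, 0],
    !![0, 0, 0, 0, 1; 0, 1, 0, 0, 0; 0, 0, 1, 0, 0; 0, 0, 0, 1, 0; 1, 0, 0, 0, 0]]

/-- Evaluating the sparse table once for a general `f` keeps the entries in `wick_coef` short. -/
theorem sum_mul_wick (κ : ℂ) (f : Fin 5 → Fin 5 → ℂ) (r : Fin 5) :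
    ∑ p, ∑ p', f p p' * wick κ r p p' =
      ![f 0 0 + 2 * (f 1 1 + f 2 2 + f 3 3) + 4 * f 4 4,
        κ * (f 0 1 + f 1 0 + 2 * (f 1 4 + f 4 1) + 2 * Complex.I * (f 2 3 - f 3 2)),
        κ * (f 0 2 + f 2 0 + 2 * (f 2 4 + f 4 2) + 2 * Complex.I * (f 3 1 - f 1 3)),
        κ * (f 0 3 + f 3 0 + 2 * (f 3 4 + f 4 3) + 2 * Complex.I * (f 1 2 - f 2 1)),
        κ ^ 2 * (f 0 4 + f 4 0 + f 1 1 + f 2 2 + f 3 3)] r := by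
  fin_cases r <;> simp [Fin.sum_univ_five, wick] <;> ring

theorem sum_mul_spinTable (f : Fin 5 → Fin 5 → ℂ) (r : Fin 5) :
    ∑ p, ∑ p', f p p' * spinTable r p p' =
      ![f 0 0, f 0 1 + f 1 0, f 0 2 + f 2 0, f 0 3 + f 3 0,
        f 0 4 + f 4 0 + f 1 1 + f 2 2 + f 3 3] r := by
  fin_cases r <;> simp [Fin.sum_univ_five, spinTable]
  ring

theorem spinBasis_mul (N : ℕ) (s : Species) (n k : ℕ) (p p' : Fin 5) :
    spinBasis N s n k p * spinBasis N s n k p' = ∑ r, spinTable r p p' • spinBasis N s n k r := by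
  have h1 := spinVec_mul_spinVec N s n k
  have h2 := spinVec_mul_spinSq N s n k
  have h3 := spinSq_mul_spinSq N s n k
  have h4 : ∀ j, spinSq N s n k * spinVec N s n k j = 0 := fun j => by
    rw [spinSq_mul_comm, h2]
  fin_cases p <;> fin_cases p' <;>
    simp [spinBasis, spinTable, Fin.sum_univ_five, h1, h2, h3, h4]

theorem average_spinBasis_mul {N n : ℕ} (h : n ≤ N) (s : Species) (i : ℕ) (p p' : Fin 5) :
    average {n} (spinBasis N s n (2 * i) p * spinBasis N s n (2 * i + 1) p') =
      ∑ r, wick (scaling s ^ 2) r p p' • spinBasis N s (n + 1) i r := by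
  have g1 : 2 * i / 2 = i := by omega
  have g2 : (2 * i + 1) / 2 = i := by omega
  have h01 := average_spinVec_mul_spinVec h s i (j := 0) (l := 1) (m := 2) (by simp)
  have h12 := average_spinVec_mul_spinVec h s i (j := 1) (l := 2) (m := 0) (by simp)
  have h20 := average_spinVec_mul_spinVec h s i (j := 2) (l := 0) (m := 1) (by simp)
  fin_cases p <;> fin_cases p' <;>
    simp [spinBasis, wick, Fin.sum_univ_five, average_one, average_spinVec h, average_spinSq h,
      average_spinVec_mul_self h, average_spinVec_mul_spinSq h, average_spinSq_mul_spinVec h,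
      average_spinSq_mul_spinSq h, h01, h12, h20, g1, g2, ← pow_mul]

theorem average_mul_of_species (S : Set ℕ) {x y : Grassmann}
    (hx : x ∈ fieldAlg (fieldsIn {x | x.species = .electron}))
    (hy : y ∈ fieldAlg (fieldsIn {x | x.species = .impurity})) :
    average S (x * y) = average S x * average S y := by
  refine average_mul_of_orthogonal S (covariance_eq_zero ?_) hx hy
  intro x hx y hy _ _
  have : x.species ≠ y.species := by
    rw [Set.mem_ofPred_eq] at hx hy
    rw [hx, hy]
    decide
  simp [propagator, this]

theorem spinBasis_mem_species (N : ℕ) (s : Species) (n k : ℕ) (p : Fin 5) :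
    spinBasis N s n k p ∈ fieldAlg (fieldsIn {x | x.species = s}) :=
  fieldAlg_mono (fun _ hx => hx.1) (spinBasis_mem_fieldAlg N s n k p)

theorem spinBasis_mul_mul_mul (N n k k' : ℕ) (p q p' q' : Fin 5) :
    spinBasis N .electron n k p * spinBasis N .impurity n k q *
      (spinBasis N .electron n k' p' * spinBasis N .impurity n k' q') =
    spinBasis N .electron n k p * spinBasis N .electron n k' p' *
      (spinBasis N .impurity n k q * spinBasis N .impurity n k' q') := by
  rw [mul_assoc, ← mul_assoc (spinBasis N .impurity n k q), spinBasis_mul_comm N .impurity n k q,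
    mul_assoc, mul_assoc]

theorem spinComb_mul (N n k : ℕ) (X Y : Matrix (Fin 5) (Fin 5) ℂ) :
    spinComb N n k X * spinComb N n k Y = spinComb N n k fun r r' =>
      ∑ p, ∑ p', (∑ q, ∑ q', (X p q * Y p' q') * spinTable r' q q') * spinTable r p p' := by
  refine map_pairComb LinearMap.id ?_ X Y
  intro p q p' q'
  rw [LinearMap.id_apply, spinBasis_mul_mul_mul, spinBasis_mul, spinBasis_mul]

theorem average_spinComb_mul {N n : ℕ} (h : n ≤ N) (i : ℕ) (X Y : Matrix (Fin 5) (Fin 5) ℂ) :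
    average {n} (spinComb N n (2 * i) X * spinComb N n (2 * i + 1) Y) =
      spinComb N (n + 1) i fun r r' =>
        ∑ p, ∑ p', (∑ q, ∑ q', (X p q * Y p' q') * wick 1 r' q q') * wick (1 / 2) r p p' := by
  refine map_pairComb (average {n}) ?_ X Y
  intro p q p' q'
  -- Each uncontracted bilinear carries two scaling factors, so the parameter of the table is
  -- `(2^{-1/2})² = 1/2` for electrons and `1` for the impurity.
  have he : scaling .electron ^ 2 = 1 / 2 := by
    rw [scaling, inv_pow, ← Complex.ofReal_pow, Real.sq_sqrt (by norm_num)]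
    norm_num
  have hi : scaling .impurity ^ 2 = 1 := by simp [scaling]
  rw [spinBasis_mul_mul_mul, average_mul_of_species _
      (mul_mem (spinBasis_mem_species _ _ _ _ _) (spinBasis_mem_species _ _ _ _ _))
      (mul_mem (spinBasis_mem_species _ _ _ _ _) (spinBasis_mem_species _ _ _ _ _)),
    average_spinBasis_mul h, average_spinBasis_mul h, he, hi]

/-! ### The nine couplings -/

/-- The numerator of the beta function, over `ℂ`. -/
def betaNum (l : Fin 9 → ℂ) : Fin 9 → ℂ :=
  ![l 0 - 2 * (l 0 * l 6) + 18 * (l 0 * l 3) + 3 * (l 0 * l 2) + 3 * (l 0 * l 1) - 2 * l 0 ^ 2,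
    1 / 2 * l 1 + 9 * (l 2 * l 3) + 3 / 2 * l 8 ^ 2 + 1 / 12 * l 6 ^ 2 + 1 / 2 * (l 5 * l 7)
      + 1 / 24 * l 4 ^ 2 + 1 / 6 * (l 0 * l 6) + 1 / 4 * l 0 ^ 2,
    2 * l 2 + 36 * (l 1 * l 3) + l 0 ^ 2 + 6 * l 7 ^ 2 + 1 / 3 * l 6 ^ 2 + 1 / 6 * l 5 ^ 2
      + 2 * (l 4 * l 8) + 2 / 3 * (l 0 * l 6),
    1 / 2 * l 3 + 1 / 4 * (l 1 * l 2) + 1 / 24 * l 0 ^ 2 + 1 / 36 * (l 0 * l 6)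
      + 1 / 72 * l 6 ^ 2 + 1 / 12 * (l 5 * l 7) + 1 / 12 * (l 4 * l 8),
    l 4 + 6 * (l 6 * l 7) + l 5 * l 6 + 108 * (l 3 * l 8) + 18 * (l 2 * l 8) + 3 * (l 1 * l 4)
      + 6 * (l 0 * l 7) + l 0 * l 5,
    2 * l 5 + 12 * (l 6 * l 8) + 2 * (l 4 * l 6) + 216 * (l 3 * l 7) + 6 * (l 2 * l 5)
      + 36 * (l 1 * l 7) + 12 * (l 0 * l 8) + 2 * (l 0 * l 4),
    l 6 + 18 * (l 7 * l 8) + 3 * (l 5 * l 8) + 3 * (l 4 * l 7) + 1 / 2 * (l 4 * l 5)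
      + 18 * (l 3 * l 6) + 3 * (l 2 * l 6) + 3 * (l 1 * l 6) + 2 * (l 0 * l 6),
    1 / 2 * l 7 + 1 / 2 * (l 6 * l 8) + 1 / 12 * (l 4 * l 6) + 3 / 2 * (l 3 * l 5)
      + 3 / 2 * (l 2 * l 7) + 1 / 4 * (l 1 * l 5) + 1 / 2 * (l 0 * l 8) + 1 / 12 * (l 0 * l 4),
    l 8 + l 6 * l 7 + 1 / 6 * (l 5 * l 6) + 3 * (l 3 * l 4) + 1 / 2 * (l 2 * l 4)
      + 3 * (l 1 * l 8) + l 0 * l 7 + 1 / 6 * (l 0 * l 5)]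

/-- The constant `C`, over `ℂ`. -/
def betaCC (l : Fin 9 → ℂ) : ℂ :=
  1 + 2 * l 0 ^ 2 + (l 0 + l 6) ^ 2 + 9 * l 1 ^ 2 + 9 * l 2 ^ 2 + 324 * l 3 ^ 2
    + 1 / 2 * l 4 ^ 2 + 1 / 2 * l 5 ^ 2 + 18 * l 7 ^ 2 + 18 * l 8 ^ 2

/-- The same matrix sits on both halves, so antisymmetry in one species pairs with antisymmetry in
the other and the commutator terms enter only as products with `i² = -1`. They yield the terms
`-2ℓ₀² - 2ℓ₀ℓ₆` of `r₀` and `2ℓ₀ℓ₆` of `r₆`. The multipliers below are the cofactors of the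
relations `|w|² = 1` and `i² = -1`. -/
theorem wick_coef (l : Fin 9 → ℂ) (w : Fin 3 → ℂ) (hw : w 0 ^ 2 + w 1 ^ 2 + w 2 ^ 2 = 1) :
    (fun r r' => ∑ p, ∑ p', (∑ q, ∑ q', (coef 1 l w p q * coef 1 l w p' q') * wick 1 r' q q') *
      wick (1 / 2) r p p') = coef (betaCC l) (betaNum l) w := by
  ext r q
  simp only [sum_mul_wick]
  fin_cases r
  · fin_cases q
    · simp only [coef, betaCC, betaNum, Matrix.of_apply, Matrix.cons_val, Matrix.cons_val_zero,
        Matrix.cons_val_one, Fin.zero_eta, Fin.mk_one, Fin.reduceFinMk, Fin.isValue]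
      linear_combination (2 * l 0 * l 6 + 1 / 2 * l 4 ^ 2 + 1 / 2 * l 5 ^ 2 + l 6 ^ 2 * w 0 ^ 2
        + l 6 ^ 2 * w 1 ^ 2 + l 6 ^ 2 * w 2 ^ 2 + l 6 ^ 2 + 18 * l 7 ^ 2 + 18 * l 8 ^ 2) *
        hw
    · simp only [coef, betaCC, betaNum, Matrix.of_apply, Matrix.cons_val, Matrix.cons_val_zero,
        Matrix.cons_val_one, Fin.zero_eta, Fin.mk_one, Fin.reduceFinMk, Fin.isValue]
      linear_combination (l 4 * l 6 * w 0 + 6 * l 6 * l 8 * w 0) * hw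
    · simp only [coef, betaCC, betaNum, Matrix.of_apply, Matrix.cons_val, Matrix.cons_val_zero,
        Matrix.cons_val_one, Fin.zero_eta, Fin.mk_one, Fin.reduceFinMk, Fin.isValue]
      linear_combination (l 4 * l 6 * w 1 + 6 * l 6 * l 8 * w 1) * hw
    · simp only [coef, betaCC, betaNum, Matrix.of_apply, Matrix.cons_val, Matrix.cons_val_zero,
        Matrix.cons_val_one, Fin.zero_eta, Fin.mk_one, Fin.reduceFinMk, Fin.isValue]
      linear_combination (l 4 * l 6 * w 2 + 6 * l 6 * l 8 * w 2) * hw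
    · simp only [coef, betaCC, betaNum, Matrix.of_apply, Matrix.cons_val, Matrix.cons_val_zero,
        Matrix.cons_val_one, Fin.zero_eta, Fin.mk_one, Fin.reduceFinMk, Fin.isValue]
      linear_combination (l 0 * l 6 + 3 * l 4 * l 8 + 1 / 4 * l 5 ^ 2 + 1 / 2 * l 6 ^ 2 * w 0 ^
        2 + 1 / 2 * l 6 ^ 2 * w 1 ^ 2 + 1 / 2 * l 6 ^ 2 * w 2 ^ 2 + 1 / 2 * l 6 ^ 2 + 9 *
        l 7 ^ 2) * hw
  · fin_cases q
    · simp only [coef, betaCC, betaNum, Matrix.of_apply, Matrix.cons_val, Matrix.cons_val_zero,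
        Matrix.cons_val_one, Fin.zero_eta, Fin.mk_one, Fin.reduceFinMk, Fin.isValue]
      linear_combination (1 / 2 * l 5 * l 6 * w 0 + 3 * l 6 * l 7 * w 0) * hw
    · simp only [coef, betaCC, betaNum, Matrix.of_apply, Matrix.cons_val, Matrix.cons_val_zero,
        Matrix.cons_val_one, Fin.zero_eta, Fin.mk_one, Fin.reduceFinMk, Fin.isValue]
      linear_combination (l 0 ^ 2 + l 0 * l 6 * w 1 ^ 2 + l 0 * l 6 * w 2 ^ 2) * Complex.I_sq +
        (-l 0 * l 6) * hw
    · simp only [coef, betaCC, betaNum, Matrix.of_apply, Matrix.cons_val, Matrix.cons_val_zero,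
        Matrix.cons_val_one, Fin.zero_eta, Fin.mk_one, Fin.reduceFinMk, Fin.isValue]
      linear_combination (-l 0 * l 6 * w 0 * w 1) * Complex.I_sq
    · simp only [coef, betaCC, betaNum, Matrix.of_apply, Matrix.cons_val, Matrix.cons_val_zero,
        Matrix.cons_val_one, Fin.zero_eta, Fin.mk_one, Fin.reduceFinMk, Fin.isValue]
      linear_combination (-l 0 * l 6 * w 0 * w 2) * Complex.I_sq
    · simp only [coef, betaCC, betaNum, Matrix.of_apply, Matrix.cons_val, Matrix.cons_val_zero,
        Matrix.cons_val_one, Fin.zero_eta, Fin.mk_one, Fin.reduceFinMk, Fin.isValue]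
      linear_combination (1 / 4 * l 5 * l 6 * w 0 + 3 / 2 * l 6 * l 7 * w 0) * hw
  · fin_cases q
    · simp only [coef, betaCC, betaNum, Matrix.of_apply, Matrix.cons_val, Matrix.cons_val_zero,
        Matrix.cons_val_one, Fin.zero_eta, Fin.mk_one, Fin.reduceFinMk, Fin.isValue]
      linear_combination (1 / 2 * l 5 * l 6 * w 1 + 3 * l 6 * l 7 * w 1) * hw
    · simp only [coef, betaCC, betaNum, Matrix.of_apply, Matrix.cons_val, Matrix.cons_val_zero,
        Matrix.cons_val_one, Fin.zero_eta, Fin.mk_one, Fin.reduceFinMk, Fin.isValue]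
      linear_combination (-l 0 * l 6 * w 0 * w 1) * Complex.I_sq
    · simp only [coef, betaCC, betaNum, Matrix.of_apply, Matrix.cons_val, Matrix.cons_val_zero,
        Matrix.cons_val_one, Fin.zero_eta, Fin.mk_one, Fin.reduceFinMk, Fin.isValue]
      linear_combination (l 0 ^ 2 + l 0 * l 6 * w 0 ^ 2 + l 0 * l 6 * w 2 ^ 2) * Complex.I_sq +
        (-l 0 * l 6) * hw
    · simp only [coef, betaCC, betaNum, Matrix.of_apply, Matrix.cons_val, Matrix.cons_val_zero,
        Matrix.cons_val_one, Fin.zero_eta, Fin.mk_one, Fin.reduceFinMk, Fin.isValue]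
      linear_combination (-l 0 * l 6 * w 1 * w 2) * Complex.I_sq
    · simp only [coef, betaCC, betaNum, Matrix.of_apply, Matrix.cons_val, Matrix.cons_val_zero,
        Matrix.cons_val_one, Fin.zero_eta, Fin.mk_one, Fin.reduceFinMk, Fin.isValue]
      linear_combination (1 / 4 * l 5 * l 6 * w 1 + 3 / 2 * l 6 * l 7 * w 1) * hw
  · fin_cases q
    · simp only [coef, betaCC, betaNum, Matrix.of_apply, Matrix.cons_val, Matrix.cons_val_zero,
        Matrix.cons_val_one, Fin.zero_eta, Fin.mk_one, Fin.reduceFinMk, Fin.isValue]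
      linear_combination (1 / 2 * l 5 * l 6 * w 2 + 3 * l 6 * l 7 * w 2) * hw
    · simp only [coef, betaCC, betaNum, Matrix.of_apply, Matrix.cons_val, Matrix.cons_val_zero,
        Matrix.cons_val_one, Fin.zero_eta, Fin.mk_one, Fin.reduceFinMk, Fin.isValue]
      linear_combination (-l 0 * l 6 * w 0 * w 2) * Complex.I_sq
    · simp only [coef, betaCC, betaNum, Matrix.of_apply, Matrix.cons_val, Matrix.cons_val_zero,
        Matrix.cons_val_one, Fin.zero_eta, Fin.mk_one, Fin.reduceFinMk, Fin.isValue]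
      linear_combination (-l 0 * l 6 * w 1 * w 2) * Complex.I_sq
    · simp only [coef, betaCC, betaNum, Matrix.of_apply, Matrix.cons_val, Matrix.cons_val_zero,
        Matrix.cons_val_one, Fin.zero_eta, Fin.mk_one, Fin.reduceFinMk, Fin.isValue]
      linear_combination (l 0 ^ 2 + l 0 * l 6 * w 0 ^ 2 + l 0 * l 6 * w 1 ^ 2) * Complex.I_sq +
        (-l 0 * l 6) * hw
    · simp only [coef, betaCC, betaNum, Matrix.of_apply, Matrix.cons_val, Matrix.cons_val_zero,
        Matrix.cons_val_one, Fin.zero_eta, Fin.mk_one, Fin.reduceFinMk, Fin.isValue]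
      linear_combination (1 / 4 * l 5 * l 6 * w 2 + 3 / 2 * l 6 * l 7 * w 2) * hw
  · fin_cases q
    · simp only [coef, betaCC, betaNum, Matrix.of_apply, Matrix.cons_val, Matrix.cons_val_zero,
        Matrix.cons_val_one, Fin.zero_eta, Fin.mk_one, Fin.reduceFinMk, Fin.isValue]
      linear_combination (1 / 4 * l 0 * l 6 + 1 / 16 * l 4 ^ 2 + 3 / 4 * l 5 * l 7 + 1 / 8 * l 6
        ^ 2 * w 0 ^ 2 + 1 / 8 * l 6 ^ 2 * w 1 ^ 2 + 1 / 8 * l 6 ^ 2 * w 2 ^ 2 + 1 / 8 * l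
        6 ^ 2 + 9 / 4 * l 8 ^ 2) * hw
    · simp only [coef, betaCC, betaNum, Matrix.of_apply, Matrix.cons_val, Matrix.cons_val_zero,
        Matrix.cons_val_one, Fin.zero_eta, Fin.mk_one, Fin.reduceFinMk, Fin.isValue]
      linear_combination (1 / 8 * l 4 * l 6 * w 0 + 3 / 4 * l 6 * l 8 * w 0) * hw
    · simp only [coef, betaCC, betaNum, Matrix.of_apply, Matrix.cons_val, Matrix.cons_val_zero,
        Matrix.cons_val_one, Fin.zero_eta, Fin.mk_one, Fin.reduceFinMk, Fin.isValue]
      linear_combination (1 / 8 * l 4 * l 6 * w 1 + 3 / 4 * l 6 * l 8 * w 1) * hw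
    · simp only [coef, betaCC, betaNum, Matrix.of_apply, Matrix.cons_val, Matrix.cons_val_zero,
        Matrix.cons_val_one, Fin.zero_eta, Fin.mk_one, Fin.reduceFinMk, Fin.isValue]
      linear_combination (1 / 8 * l 4 * l 6 * w 2 + 3 / 4 * l 6 * l 8 * w 2) * hw
    · simp only [coef, betaCC, betaNum, Matrix.of_apply, Matrix.cons_val, Matrix.cons_val_zero,
        Matrix.cons_val_one, Fin.zero_eta, Fin.mk_one, Fin.reduceFinMk, Fin.isValue]
      linear_combination (1 / 8 * l 0 * l 6 + 3 / 8 * l 4 * l 8 + 3 / 8 * l 5 * l 7 + 1 / 16 * l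
        6 ^ 2 * w 0 ^ 2 + 1 / 16 * l 6 ^ 2 * w 1 ^ 2 + 1 / 16 * l 6 ^ 2 * w 2 ^ 2 + 1 / 16
        * l 6 ^ 2) * hw

/-- The product of two linear combinations of the operators at a half-box. -/
def couplingMul (l m : Fin 9 → ℝ) : Fin 9 → ℝ :=
  ![0, 1 / 6 * (l 4 * m 4), 1 / 6 * (l 5 * m 5),
    1 / 6 * (l 0 * m 0) + 1 / 18 * (l 0 * m 6 + l 6 * m 0) + 1 / 18 * (l 6 * m 6) +
      1 / 2 * (l 1 * m 2 + l 2 * m 1) + 1 / 6 * (l 5 * m 7 + l 7 * m 5) +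
      1 / 6 * (l 4 * m 8 + l 8 * m 4),
    0, 0, 1 / 2 * (l 4 * m 5 + l 5 * m 4),
    1 / 6 * (l 0 * m 4 + l 4 * m 0) + 1 / 2 * (l 1 * m 5 + l 5 * m 1) +
      1 / 6 * (l 4 * m 6 + l 6 * m 4),
    1 / 6 * (l 0 * m 5 + l 5 * m 0) + 1 / 2 * (l 2 * m 4 + l 4 * m 2) +
      1 / 6 * (l 5 * m 6 + l 6 * m 5)]

/-- The norm of `w` enters only through the squares `S`, that is in the last row and column, where
two components along `w` meet. -/
theorem spinTable_coef (l m : Fin 9 → ℝ) (w : Fin 3 → ℂ)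
    (hw : w 0 ^ 2 + w 1 ^ 2 + w 2 ^ 2 = 1) :
    (fun r r' => ∑ p, ∑ p', (∑ q, ∑ q', (coef 0 (fun j => (l j : ℂ)) w p q *
      coef 0 (fun j => (m j : ℂ)) w p' q') * spinTable r' q q') * spinTable r p p') =
      coef 0 (fun j => (couplingMul l m j : ℂ)) w := by
  ext r q
  simp only [sum_mul_spinTable]
  fin_cases r
  · fin_cases q
    · simp only [coef, couplingMul, Matrix.of_apply, Matrix.cons_val, Matrix.cons_val_zero,
        Matrix.cons_val_one, Fin.zero_eta, Fin.mk_one, Fin.reduceFinMk, Fin.isValue]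
      push_cast
      ring
    · simp only [coef, couplingMul, Matrix.of_apply, Matrix.cons_val, Matrix.cons_val_zero,
        Matrix.cons_val_one, Fin.zero_eta, Fin.mk_one, Fin.reduceFinMk, Fin.isValue]
      push_cast
      ring
    · simp only [coef, couplingMul, Matrix.of_apply, Matrix.cons_val, Matrix.cons_val_zero,
        Matrix.cons_val_one, Fin.zero_eta, Fin.mk_one, Fin.reduceFinMk, Fin.isValue]
      push_cast
      ring
    · simp only [coef, couplingMul, Matrix.of_apply, Matrix.cons_val, Matrix.cons_val_zero,
        Matrix.cons_val_one, Fin.zero_eta, Fin.mk_one, Fin.reduceFinMk, Fin.isValue]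
      push_cast
      ring
    · simp only [coef, couplingMul, Matrix.of_apply, Matrix.cons_val, Matrix.cons_val_zero,
        Matrix.cons_val_one, Fin.zero_eta, Fin.mk_one, Fin.reduceFinMk, Fin.isValue]
      push_cast
      linear_combination (1 / 4 * l 5 * m 5) * hw
  · fin_cases q
    · simp only [coef, couplingMul, Matrix.of_apply, Matrix.cons_val, Matrix.cons_val_zero,
        Matrix.cons_val_one, Fin.zero_eta, Fin.mk_one, Fin.reduceFinMk, Fin.isValue]
      push_cast
      ring
    · simp only [coef, couplingMul, Matrix.of_apply, Matrix.cons_val, Matrix.cons_val_zero,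
        Matrix.cons_val_one, Fin.zero_eta, Fin.mk_one, Fin.reduceFinMk, Fin.isValue]
      push_cast
      ring
    · simp only [coef, couplingMul, Matrix.of_apply, Matrix.cons_val, Matrix.cons_val_zero,
        Matrix.cons_val_one, Fin.zero_eta, Fin.mk_one, Fin.reduceFinMk, Fin.isValue]
      push_cast
      ring
    · simp only [coef, couplingMul, Matrix.of_apply, Matrix.cons_val, Matrix.cons_val_zero,
        Matrix.cons_val_one, Fin.zero_eta, Fin.mk_one, Fin.reduceFinMk, Fin.isValue]
      push_cast
      ring
    · simp only [coef, couplingMul, Matrix.of_apply, Matrix.cons_val, Matrix.cons_val_zero,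
        Matrix.cons_val_one, Fin.zero_eta, Fin.mk_one, Fin.reduceFinMk, Fin.isValue]
      push_cast
      linear_combination (1 / 4 * l 5 * m 6 * w 0 + 1 / 4 * l 6 * m 5 * w 0) * hw
  · fin_cases q
    · simp only [coef, couplingMul, Matrix.of_apply, Matrix.cons_val, Matrix.cons_val_zero,
        Matrix.cons_val_one, Fin.zero_eta, Fin.mk_one, Fin.reduceFinMk, Fin.isValue]
      push_cast
      ring
    · simp only [coef, couplingMul, Matrix.of_apply, Matrix.cons_val, Matrix.cons_val_zero,
        Matrix.cons_val_one, Fin.zero_eta, Fin.mk_one, Fin.reduceFinMk, Fin.isValue]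
      push_cast
      ring
    · simp only [coef, couplingMul, Matrix.of_apply, Matrix.cons_val, Matrix.cons_val_zero,
        Matrix.cons_val_one, Fin.zero_eta, Fin.mk_one, Fin.reduceFinMk, Fin.isValue]
      push_cast
      ring
    · simp only [coef, couplingMul, Matrix.of_apply, Matrix.cons_val, Matrix.cons_val_zero,
        Matrix.cons_val_one, Fin.zero_eta, Fin.mk_one, Fin.reduceFinMk, Fin.isValue]
      push_cast
      ring
    · simp only [coef, couplingMul, Matrix.of_apply, Matrix.cons_val, Matrix.cons_val_zero,
        Matrix.cons_val_one, Fin.zero_eta, Fin.mk_one, Fin.reduceFinMk, Fin.isValue]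
      push_cast
      linear_combination (1 / 4 * l 5 * m 6 * w 1 + 1 / 4 * l 6 * m 5 * w 1) * hw
  · fin_cases q
    · simp only [coef, couplingMul, Matrix.of_apply, Matrix.cons_val, Matrix.cons_val_zero,
        Matrix.cons_val_one, Fin.zero_eta, Fin.mk_one, Fin.reduceFinMk, Fin.isValue]
      push_cast
      ring
    · simp only [coef, couplingMul, Matrix.of_apply, Matrix.cons_val, Matrix.cons_val_zero,
        Matrix.cons_val_one, Fin.zero_eta, Fin.mk_one, Fin.reduceFinMk, Fin.isValue]
      push_cast
      ring
    · simp only [coef, couplingMul, Matrix.of_apply, Matrix.cons_val, Matrix.cons_val_zero,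
        Matrix.cons_val_one, Fin.zero_eta, Fin.mk_one, Fin.reduceFinMk, Fin.isValue]
      push_cast
      ring
    · simp only [coef, couplingMul, Matrix.of_apply, Matrix.cons_val, Matrix.cons_val_zero,
        Matrix.cons_val_one, Fin.zero_eta, Fin.mk_one, Fin.reduceFinMk, Fin.isValue]
      push_cast
      ring
    · simp only [coef, couplingMul, Matrix.of_apply, Matrix.cons_val, Matrix.cons_val_zero,
        Matrix.cons_val_one, Fin.zero_eta, Fin.mk_one, Fin.reduceFinMk, Fin.isValue]
      push_cast
      linear_combination (1 / 4 * l 5 * m 6 * w 2 + 1 / 4 * l 6 * m 5 * w 2) * hw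
  · fin_cases q
    · simp only [coef, couplingMul, Matrix.of_apply, Matrix.cons_val, Matrix.cons_val_zero,
        Matrix.cons_val_one, Fin.zero_eta, Fin.mk_one, Fin.reduceFinMk, Fin.isValue]
      push_cast
      linear_combination (1 / 4 * l 4 * m 4) * hw
    · simp only [coef, couplingMul, Matrix.of_apply, Matrix.cons_val, Matrix.cons_val_zero,
        Matrix.cons_val_one, Fin.zero_eta, Fin.mk_one, Fin.reduceFinMk, Fin.isValue]
      push_cast
      linear_combination (1 / 4 * l 4 * m 6 * w 0 + 1 / 4 * l 6 * m 4 * w 0) * hw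
    · simp only [coef, couplingMul, Matrix.of_apply, Matrix.cons_val, Matrix.cons_val_zero,
        Matrix.cons_val_one, Fin.zero_eta, Fin.mk_one, Fin.reduceFinMk, Fin.isValue]
      push_cast
      linear_combination (1 / 4 * l 4 * m 6 * w 1 + 1 / 4 * l 6 * m 4 * w 1) * hw
    · simp only [coef, couplingMul, Matrix.of_apply, Matrix.cons_val, Matrix.cons_val_zero,
        Matrix.cons_val_one, Fin.zero_eta, Fin.mk_one, Fin.reduceFinMk, Fin.isValue]
      push_cast
      linear_combination (1 / 4 * l 4 * m 6 * w 2 + 1 / 4 * l 6 * m 4 * w 2) * hw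
    · simp only [coef, couplingMul, Matrix.of_apply, Matrix.cons_val, Matrix.cons_val_zero,
        Matrix.cons_val_one, Fin.zero_eta, Fin.mk_one, Fin.reduceFinMk, Fin.isValue]
      push_cast
      linear_combination (1 / 4 * l 0 * m 6 + 3 / 4 * l 4 * m 8 + 3 / 4 * l 5 * m 7 + 1 / 4 * l
        6 * m 0 + 1 / 4 * l 6 * m 6 * w 0 ^ 2 + 1 / 4 * l 6 * m 6 * w 1 ^ 2 + 1 / 4 * l 6
        * m 6 * w 2 ^ 2 + 1 / 4 * l 6 * m 6 + 3 / 4 * l 7 * m 5 + 3 / 4 * l 8 * m 4) * hw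

/-! ### One step of the renormalization group -/

/-- The inverse of `alphaToEll`. -/
def ellToAlpha (l : Fin 9 → ℝ) : Fin 9 → ℝ :=
  let a1 := l 1 - 1 / 12 * l 4 ^ 2
  let a2 := l 2 - 1 / 12 * l 5 ^ 2
  let a6 := l 6 - 1 / 2 * (l 4 * l 5)
  let a7 := l 7 - (1 / 6 * (l 0 * l 4) + 1 / 2 * (a1 * l 5) + 1 / 6 * (l 4 * a6)
      + 1 / 24 * (l 4 ^ 2 * l 5))
  let a8 := l 8 - (1 / 6 * (l 0 * l 5) + 1 / 2 * (a2 * l 4) + 1 / 6 * (l 5 * a6)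
      + 1 / 24 * (l 4 * l 5 ^ 2))
  ![l 0, a1, a2,
    l 3 - (1 / 12 * l 0 ^ 2 + 1 / 18 * (l 0 * a6) + 1 / 2 * (a1 * a2) + 1 / 6 * (l 4 * a8)
      + 1 / 6 * (l 5 * a7) + 1 / 36 * a6 ^ 2 + 1 / 36 * (l 0 * l 4 * l 5)
      + 1 / 24 * (a1 * l 5 ^ 2) + 1 / 24 * (a2 * l 4 ^ 2) + 1 / 36 * (l 4 * l 5 * a6)
      + 1 / 288 * (l 4 ^ 2 * l 5 ^ 2)),
    l 4, l 5, a6, a7, a8]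

/-- Every `ℓ_n` is `α_n` plus a polynomial in couplings of operators of lower degree in the spins,
so the system is solved by substitution: `0, 4, 5`, then `1, 2, 6`, then `7, 8`, and finally `3`. -/
theorem alphaToEll_ellToAlpha (l : Fin 9 → ℝ) : alphaToEll (ellToAlpha l) = l := by
  ext j
  fin_cases j <;> simp [alphaToEll, ellToAlpha] <;> ring

theorem ellToAlpha_alphaToEll (a : Fin 9 → ℝ) : ellToAlpha (alphaToEll a) = a := by
  ext j
  fin_cases j <;> simp [alphaToEll, ellToAlpha]

theorem alphaToEll_bijective : Function.Bijective alphaToEll :=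
  Function.bijective_iff_has_inverse.2 ⟨ellToAlpha, ellToAlpha_alphaToEll, alphaToEll_ellToAlpha⟩

theorem one_le_betaC (l : Fin 9 → ℝ) : 1 ≤ betaC l := by
  unfold betaC
  have h : 0 ≤ 2 * l 0 ^ 2 + (l 0 + l 6) ^ 2 + 9 * l 1 ^ 2 + 9 * l 2 ^ 2 + 324 * l 3 ^ 2
    + 1 / 2 * l 4 ^ 2 + 1 / 2 * l 5 ^ 2 + 18 * l 7 ^ 2 + 18 * l 8 ^ 2 := by positivity
  linarith

theorem betaC_pos (l : Fin 9 → ℝ) : 0 < betaC l := zero_lt_one.trans_le (one_le_betaC l)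

theorem ofReal_betaC (l : Fin 9 → ℝ) : (betaC l : ℂ) = betaCC fun j => (l j : ℂ) := by
  simp [betaC, betaCC]

theorem ofReal_betaMap (l : Fin 9 → ℝ) :
    ((betaC l : ℂ) • fun p => (betaMap l p : ℂ)) = betaNum fun j => (l j : ℂ) := by
  ext p
  have h : betaC l * betaMap l p = ((betaC l) • betaMap l) p := rfl
  rw [Pi.smul_apply, smul_eq_mul, ← Complex.ofReal_mul, h, betaMap, smul_smul,
    mul_inv_cancel₀ (betaC_pos l).ne', one_smul, betaNum]
  fin_cases p <;> simp

theorem opComb_add (dir : EuclideanSpace ℝ (Fin 3)) (N n k : ℕ) (a b : Fin 9 → ℝ) :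
    opComb dir N n k (a + b) = opComb dir N n k a + opComb dir N n k b := by
  simp [opComb, add_smul, Finset.sum_add_distrib]

theorem opComb_smul (dir : EuclideanSpace ℝ (Fin 3)) (N n k : ℕ) (c : ℝ) (a : Fin 9 → ℝ) :
    opComb dir N n k (c • a) = (c : ℂ) • opComb dir N n k a := by
  simp only [opComb, Finset.smul_sum, smul_smul, Pi.smul_apply, smul_eq_mul, Complex.ofReal_mul]

theorem opComb_zero (dir : EuclideanSpace ℝ (Fin 3)) (N n k : ℕ) :
    opComb dir N n k 0 = 0 := by
  simp [opComb]

theorem opComb_eq_spinComb (dir : EuclideanSpace ℝ (Fin 3)) (N n k : ℕ) (l : Fin 9 → ℝ) :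
    opComb dir N n k l = spinComb N n k (coef 0 (fun p => (l p : ℂ)) fun j => (dir j : ℂ)) := by
  rw [← smul_one_add_opComb, zero_smul, zero_add]

theorem spinComb_mem_center (N n k : ℕ) (X : Matrix (Fin 5) (Fin 5) ℂ) :
    spinComb N n k X ∈ Subalgebra.center ℂ Grassmann := by
  rw [spinComb, pairComb]
  exact Subalgebra.sum_mem _ fun p _ => Subalgebra.sum_mem _ fun q _ => Subalgebra.smul_mem _
    (mul_mem (spinBasis_mem_center _ _ _ _ p) (spinBasis_mem_center _ _ _ _ q)) _

theorem spinComb_mem_fieldAlg (N n k : ℕ) (X : Matrix (Fin 5) (Fin 5) ℂ) :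
    spinComb N n k X ∈ fieldAlg (fieldsIn {x | x.scale = n → x.half = k}) := by
  have h : ∀ s p, spinBasis N s n k p ∈ fieldAlg (fieldsIn {x | x.scale = n → x.half = k}) :=
    fun s p => fieldAlg_mono (fun _ hx => hx.2) (spinBasis_mem_fieldAlg N s n k p)
  rw [spinComb, pairComb]
  exact Subalgebra.sum_mem _ fun p _ => Subalgebra.sum_mem _ fun q _ => Subalgebra.smul_mem _
    (mul_mem (h _ p) (h _ q)) _

theorem opComb_mem_center (dir : EuclideanSpace ℝ (Fin 3)) (N n k : ℕ) (l : Fin 9 → ℝ) :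
    opComb dir N n k l ∈ Subalgebra.center ℂ Grassmann := by
  rw [opComb_eq_spinComb]
  exact spinComb_mem_center _ _ _ _

theorem opComb_mem_fieldAlg (dir : EuclideanSpace ℝ (Fin 3)) (N n k : ℕ) (l : Fin 9 → ℝ) :
    opComb dir N n k l ∈ fieldAlg (fieldsIn {x | x.scale = n → x.half = k}) := by
  rw [opComb_eq_spinComb]
  exact spinComb_mem_fieldAlg _ _ _ _

theorem sum_sq_dir {dir : EuclideanSpace ℝ (Fin 3)} (hd : ‖dir‖ = 1) :
    (dir 0 : ℂ) ^ 2 + (dir 1 : ℂ) ^ 2 + (dir 2 : ℂ) ^ 2 = 1 := by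
  have h := EuclideanSpace.norm_sq_eq dir
  rw [hd, Fin.sum_univ_three] at h
  simp only [Real.norm_eq_abs, sq_abs] at h
  exact_mod_cast h.symm.trans (by norm_num)

section Direction

variable {dir : EuclideanSpace ℝ (Fin 3)}

theorem opComb_mul (hd : ‖dir‖ = 1) (N n k : ℕ) (l m : Fin 9 → ℝ) :
    opComb dir N n k l * opComb dir N n k m = opComb dir N n k (couplingMul l m) := by
  simp only [opComb_eq_spinComb, spinComb_mul]
  congr 1
  exact spinTable_coef l m _ (sum_sq_dir hd)

/-- Each factor raises the degree in the spins by at least one, and nothing of degree above four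
survives. -/
theorem couplingMul_five (a : Fin 9 → ℝ) :
    couplingMul (couplingMul (couplingMul (couplingMul a a) a) a) a = 0 := by
  ext j
  fin_cases j <;> simp [couplingMul]

theorem opComb_pow_five (hd : ‖dir‖ = 1) (N n k : ℕ) (a : Fin 9 → ℝ) :
    opComb dir N n k a ^ 5 = 0 := by
  simp only [pow_succ, pow_zero, one_mul, opComb_mul hd, couplingMul_five, opComb_zero]

theorem isNilpotent_opComb (hd : ‖dir‖ = 1) (N n k : ℕ) (a : Fin 9 → ℝ) :
    IsNilpotent (opComb dir N n k a) := ⟨5, opComb_pow_five hd N n k a⟩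

/-- This is where the coefficients of `Λ` come from: it is the exponential series without its
constant term, computed in the algebra of couplings. -/
theorem alphaToEll_eq_exp (a : Fin 9 → ℝ) :
    alphaToEll a = a + (1 / 2 : ℝ) • couplingMul a a +
      (1 / 6 : ℝ) • couplingMul (couplingMul a a) a +
      (1 / 24 : ℝ) • couplingMul (couplingMul (couplingMul a a) a) a := by
  ext j
  fin_cases j <;>
  simp only [alphaToEll, couplingMul, Pi.add_apply, Pi.smul_apply, smul_eq_mul, Matrix.cons_val,
    Matrix.cons_val_zero, Matrix.cons_val_one, Fin.zero_eta, Fin.mk_one, Fin.reduceFinMk,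
    Fin.isValue] <;>
  ring

theorem sum_opComb_pow (hd : ‖dir‖ = 1) (N n k : ℕ) (a : Fin 9 → ℝ) :
    ∑ r ∈ Finset.range 5, ((r.factorial : ℂ)⁻¹) • opComb dir N n k a ^ r =
      1 + opComb dir N n k (alphaToEll a) := by
  rw [alphaToEll_eq_exp]
  simp only [opComb_add, opComb_smul, Finset.sum_range_succ, Finset.range_zero, Finset.sum_empty,
    pow_succ, pow_zero, one_mul, opComb_mul hd, Nat.factorial]
  push_cast
  module

theorem gexp_opComb (hd : ‖dir‖ = 1) (N n k : ℕ) (a : Fin 9 → ℝ) :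
    gexp (opComb dir N n k a) = 1 + opComb dir N n k (alphaToEll a) := by
  rw [gexp_eq_sum (opComb_pow_five hd N n k a), sum_opComb_pow hd]

theorem average_one_add_opComb (hd : ‖dir‖ = 1) {N n : ℕ} (h : n ≤ N) (i : ℕ) (l : Fin 9 → ℝ) :
    average {n} ((1 + opComb dir N n (2 * i) l) * (1 + opComb dir N n (2 * i + 1) l)) =
      (betaC l : ℂ) • (1 + opComb dir N (n + 1) i (betaMap l)) := by
  have h1 : ∀ n k l, 1 + opComb dir N n k l =
      spinComb N n k (coef 1 (fun p => (l p : ℂ)) fun j => (dir j : ℂ)) := fun n k l => by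
    rw [← smul_one_add_opComb, one_smul]
  -- Absorbing `C` into the coefficients cancels the inverse in `betaMap`, so that only the
  -- polynomial identity is needed.
  have h2 : (betaC l : ℂ) • coef 1 (fun p => (betaMap l p : ℂ)) (fun j => (dir j : ℂ)) =
      coef (betaCC fun j => (l j : ℂ)) (betaNum fun j => (l j : ℂ)) fun j => (dir j : ℂ) := by
    rw [smul_coef, mul_one, ofReal_betaMap, ofReal_betaC]
  have h3 := wick_coef (fun j => (l j : ℂ)) (fun j => (dir j : ℂ)) (sum_sq_dir hd)
  rw [← h2] at h3
  rw [h1, h1, h1, average_spinComb_mul h, h3]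
  exact pairComb_smul _ _ _ _

end Direction

/-! ### Products over boxes -/

/-- Propagators stay inside one box, so boxes average independently. Working in the center, a
commutative ring, makes the products over boxes ordinary finite products. -/
theorem average_prod_boxes {n : ℕ} {c : ℂ} {f g : ℕ → Subalgebra.center ℂ Grassmann}
    (hf : ∀ i, (f i : Grassmann) ∈ fieldAlg (fieldsIn {x | x.scale = n → x.half / 2 = i}))
    (hg : ∀ i, average {n} (f i) = c • (g i : Grassmann)) (m : ℕ) :
    average {n} ((∏ i ∈ Finset.range m, f i : Subalgebra.center ℂ Grassmann) : Grassmann) =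
      c ^ m • ((∏ i ∈ Finset.range m, g i : Subalgebra.center ℂ Grassmann) : Grassmann) := by
  induction m with
  | zero => simp [average_one]
  | succ m ih =>
    -- On the scale `n` the first `m` factors involve only boxes with number below `m`; on the other
    -- scales, which are not integrated, nothing is required.
    have hmem : ∀ m, ((∏ i ∈ Finset.range m, f i : Subalgebra.center ℂ Grassmann) : Grassmann) ∈
        fieldAlg (fieldsIn {x | x.scale = n → x.half / 2 < m}) := by
      intro m
      induction m with
      | zero => simp [one_mem]
      | succ m ih =>
        rw [Finset.prod_range_succ, Subalgebra.coe_mul]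
        refine mul_mem (fieldAlg_mono ?_ ih) (fieldAlg_mono ?_ (hf m))
        · exact fun x hx hs => (hx hs).trans (Nat.lt_succ_self m)
        · exact fun x hx hs => (hx hs).trans_lt (Nat.lt_succ_self m)
    rw [Finset.prod_range_succ, Finset.prod_range_succ, Subalgebra.coe_mul, Subalgebra.coe_mul,
      average_mul_of_orthogonal {n} (covariance_eq_zero ?_) (hmem m) (hf m), ih, hg,
      smul_mul_smul_comm, pow_succ]
    intro x hx y hy hxs hys
    have h1 : x.half / 2 < m := hx hxs
    have h2 : y.half / 2 = m := hy hys
    have : x.half / 2 ≠ y.half / 2 := by omega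
    simp [propagator, this]

theorem isNilpotent_sum_center {x : ℕ → Subalgebra.center ℂ Grassmann}
    (hx : ∀ i, IsNilpotent (x i : Grassmann)) (m : ℕ) :
    IsNilpotent ((∑ i ∈ Finset.range m, x i : Subalgebra.center ℂ Grassmann) : Grassmann) := by
  have hx' : ∀ i, IsNilpotent (x i) := fun i => by
    obtain ⟨k, hk⟩ := hx i
    exact ⟨k, Subtype.ext (by simpa using hk)⟩
  exact (isNilpotent_sum fun i _ => hx' i).map (Subalgebra.center ℂ Grassmann).val

theorem gexp_sum {x e : ℕ → Subalgebra.center ℂ Grassmann}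
    (hx : ∀ i, IsNilpotent (x i : Grassmann)) (he : ∀ i, gexp (x i) = e i) (m : ℕ) :
    gexp ((∑ i ∈ Finset.range m, x i : Subalgebra.center ℂ Grassmann) : Grassmann) =
      ((∏ i ∈ Finset.range m, e i : Subalgebra.center ℂ Grassmann) : Grassmann) := by
  induction m with
  | zero => simp [gexp_zero]
  | succ m ih =>
    rw [Finset.sum_range_succ, Finset.prod_range_succ, Subalgebra.coe_add, Subalgebra.coe_mul,
      gexp_add _ (isNilpotent_sum_center hx m) (hx m), ih, he]
    exact (Subalgebra.mem_center_iff.1 (x m).2 _)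

section Direction

variable {dir : EuclideanSpace ℝ (Fin 3)}

/-- The sum of the operators over the first `m` half-boxes. -/
def opSum (dir : EuclideanSpace ℝ (Fin 3)) (N n m : ℕ) (a : Fin 9 → ℝ) : Grassmann :=
  ∑ k ∈ Finset.range m, opComb dir N n k a

theorem opSum_two_mul (N n m : ℕ) (a : Fin 9 → ℝ) :
    opSum dir N n (2 * m) a =
      ∑ i ∈ Finset.range m, (opComb dir N n (2 * i) a + opComb dir N n (2 * i + 1) a) := by
  induction m with
  | zero => simp [opSum]
  | succ m ih =>
    rw [Finset.sum_range_succ, ← ih, opSum, opSum, show 2 * (m + 1) = 2 * m + 1 + 1 by ring,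
      Finset.sum_range_succ, Finset.sum_range_succ, add_assoc]

/-- The elements `opComb` as elements of the center. -/
def opCenter (dir : EuclideanSpace ℝ (Fin 3)) (N n k : ℕ) (a : Fin 9 → ℝ) :
    Subalgebra.center ℂ Grassmann := ⟨opComb dir N n k a, opComb_mem_center dir N n k a⟩

theorem opSum_eq_coe (N n m : ℕ) (a : Fin 9 → ℝ) :
    opSum dir N n m a = ((∑ k ∈ Finset.range m, opCenter dir N n k a :
      Subalgebra.center ℂ Grassmann) : Grassmann) := by
  have h := map_sum (Subalgebra.center ℂ Grassmann).val (fun k => opCenter dir N n k a)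
    (Finset.range m)
  simp only [Subalgebra.coe_val] at h
  rw [h, opSum]
  rfl

theorem coe_one_add_opCenter (N n k : ℕ) (a : Fin 9 → ℝ) :
    ((1 + opCenter dir N n k a : Subalgebra.center ℂ Grassmann) : Grassmann) =
      1 + opComb dir N n k a := rfl

theorem isNilpotent_opSum (hd : ‖dir‖ = 1) (N n m : ℕ) (a : Fin 9 → ℝ) :
    IsNilpotent (opSum dir N n m a) := by
  rw [opSum_eq_coe]
  exact isNilpotent_sum_center (x := fun k => opCenter dir N n k a)
    (fun i => isNilpotent_opComb hd N n i a) m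

theorem gexp_opSum (hd : ‖dir‖ = 1) (N n m : ℕ) (a : Fin 9 → ℝ) :
    gexp (opSum dir N n m a) = ((∏ k ∈ Finset.range m, (1 + opCenter dir N n k (alphaToEll a)) :
      Subalgebra.center ℂ Grassmann) : Grassmann) := by
  rw [opSum_eq_coe]
  refine gexp_sum (x := fun k => opCenter dir N n k a)
    (e := fun k => 1 + opCenter dir N n k (alphaToEll a)) ?_ ?_ m
  · exact fun i => isNilpotent_opComb hd N n i a
  · intro i
    rw [coe_one_add_opCenter]
    exact gexp_opComb hd N n i a

theorem prod_range_two_mul {R : Type*} [CommMonoid R] (f : ℕ → R) (m : ℕ) :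
    ∏ k ∈ Finset.range (2 * m), f k = ∏ i ∈ Finset.range m, (f (2 * i) * f (2 * i + 1)) := by
  induction m with
  | zero => simp
  | succ m ih =>
    rw [Finset.prod_range_succ, ← ih, show 2 * (m + 1) = 2 * m + 1 + 1 by ring,
      Finset.prod_range_succ, Finset.prod_range_succ, mul_assoc]

theorem average_gexp_opSum (hd : ‖dir‖ = 1) {N n : ℕ} (h : n ≤ N) (m : ℕ) {a b : Fin 9 → ℝ}
    (hab : alphaToEll b = betaMap (alphaToEll a)) :
    average {n} (gexp (opSum dir N n (2 * m) a)) =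
      (betaC (alphaToEll a) : ℂ) ^ m • gexp (opSum dir N (n + 1) m b) := by
  rw [gexp_opSum hd, gexp_opSum hd, prod_range_two_mul, hab]
  refine average_prod_boxes (f := fun i => (1 + opCenter dir N n (2 * i) (alphaToEll a)) *
      (1 + opCenter dir N n (2 * i + 1) (alphaToEll a)))
    (g := fun i => 1 + opCenter dir N (n + 1) i (betaMap (alphaToEll a)))
    (fun i => ?_) (fun i => ?_) m
  · have hk : ∀ k, k / 2 = i → 1 + opComb dir N n k (alphaToEll a) ∈
        fieldAlg (fieldsIn {x | x.scale = n → x.half / 2 = i}) := fun k hk => by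
      refine add_mem (one_mem _) (fieldAlg_mono ?_ (opComb_mem_fieldAlg dir N n k _))
      exact fun x hx hs => by rw [hx hs, hk]
    rw [Subalgebra.coe_mul, coe_one_add_opCenter, coe_one_add_opCenter]
    exact mul_mem (hk _ (by omega)) (hk _ (by omega))
  · rw [Subalgebra.coe_mul, coe_one_add_opCenter, coe_one_add_opCenter, coe_one_add_opCenter]
    exact average_one_add_opComb hd h i (alphaToEll a)

theorem integrateScale_opSum (hd : ‖dir‖ = 1) {N n : ℕ} (h : n ≤ N) (m : ℕ) {a b : Fin 9 → ℝ}
    (hab : alphaToEll b = betaMap (alphaToEll a)) {V : Grassmann}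
    (hV : -V = opSum dir N n (2 * m) a) :
    integrateScale n V =
      algebraMap ℂ Grassmann ((-(m * Real.log (betaC (alphaToEll a))) : ℝ) : ℂ) -
        opSum dir N (n + 1) m b := by
  have hC := betaC_pos (alphaToEll a)
  have hne : (betaC (alphaToEll a) : ℂ) ^ m ≠ 0 := by exact_mod_cast (pow_pos hC m).ne'
  -- `C ^ m` is a positive real, so the principal complex logarithm is the real number `m log C`.
  rw [integrateScale, hV, average_gexp_opSum hd h m hab,
    glog_smul_gexp hne (isNilpotent_opSum hd N (n + 1) m b), ← Complex.ofReal_pow,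
    ← Complex.ofReal_log (pow_pos hC m).le, Real.log_pow, neg_add, ← map_neg, Complex.ofReal_neg,
    sub_eq_add_neg]

theorem constTerm_algebraMap_sub {x : Grassmann} (hx : IsNilpotent x) (c : ℂ) :
    constTerm (algebraMap ℂ Grassmann c - x) = c := by
  rw [map_sub, constTerm_of_isNilpotent hx, sub_zero]
  exact AlgHom.commutes constTerm c

/-- The length `1/2` of the half-boxes on scale `0` is exactly the factor `1/2` in the operators, so
the initial couplings are `λ₀` and `h` themselves. -/
theorem neg_interaction (lam : ℝ) (N : ℕ) (h : ℝ) :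
    -interaction lam dir N h = opSum dir N 0 (2 ^ (N + 1)) ![lam, 0, 0, 0, 0, h, 0, 0, 0] := by
  have h1 : ∀ k, opComb dir N 0 k ![lam, 0, 0, 0, 0, h, 0, 0, 0] =
      (lam : ℂ) • (1 / 2 : ℂ) • dotG (spinVec N .electron 0 k) (spinVec N .impurity 0 k) +
        (h : ℂ) • (1 / 2 : ℂ) • dotR (spinVec N .impurity 0 k) dir := by
    intro k
    simp [opComb, Fin.sum_univ_succ, op]
  simp only [opSum, h1, interaction, timeIntegral, dotG, dotR, Finset.sum_add_distrib,
    Finset.smul_sum]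
  rw [neg_sub', neg_neg, sub_neg_eq_add, add_comm]
  congr 1
  · exact Finset.sum_comm
  · rw [Finset.sum_comm]
    exact Finset.sum_congr rfl fun k _ => Finset.sum_congr rfl fun j _ => by rw [smul_comm (dir j : ℂ)]

/-! ### The flow of the couplings -/

/-- The couplings `α_h^{[m]}`, `m = -n`. -/
def coupling (lam h : ℝ) : ℕ → Fin 9 → ℝ
  | 0 => ![lam, 0, 0, 0, 0, h, 0, 0, 0]
  | n + 1 => ellToAlpha (betaMap (alphaToEll (coupling lam h n)))

theorem alphaToEll_coupling_succ (lam h : ℝ) (n : ℕ) :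
    alphaToEll (coupling lam h (n + 1)) = betaMap (alphaToEll (coupling lam h n)) := by
  rw [coupling, alphaToEll_ellToAlpha]

theorem two_pow_succ_sub {N n : ℕ} (h : n ≤ N) : 2 ^ (N + 1 - n) = 2 * 2 ^ (N - n) := by
  rw [Nat.succ_sub h, pow_succ']

/-- There are `2^(N+1-n)` half-boxes on scale `-n`, and the half-boxes of the next scale are the
boxes of this one; the output of a step therefore has the form of the next input. -/
theorem neg_effPot (hd : ‖dir‖ = 1) (lam h : ℝ) (N n : ℕ) (hn : n ≤ N + 1) :
    -effPot lam dir N h n = opSum dir N n (2 ^ (N + 1 - n)) (coupling lam h n) := by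
  induction n with
  | zero => exact neg_interaction lam N h
  | succ n ih =>
    have hn' : n ≤ N := by omega
    have hV := ih (by omega)
    rw [two_pow_succ_sub hn'] at hV
    have hI := integrateScale_opSum hd hn' _ (alphaToEll_coupling_succ lam h n) hV
    rw [effPot]
    simp only [hI, constTerm_algebraMap_sub (isNilpotent_opSum hd N (n + 1) _ _)]
    rw [show N + 1 - (n + 1) = N - n by omega]
    abel

theorem freeTerm_eq (hd : ‖dir‖ = 1) (lam h : ℝ) (N n : ℕ) (hn : n ≤ N) :
    freeTerm lam dir N h n =
      ((-(2 : ℝ) ^ (-(n : ℤ)) * Real.log (betaC (alphaToEll (coupling lam h n))) : ℝ) : ℂ) := by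
  have hV := neg_effPot hd lam h N n (by omega)
  rw [two_pow_succ_sub hn] at hV
  rw [freeTerm, integrateScale_opSum hd hn _ (alphaToEll_coupling_succ lam h n) hV,
    constTerm_algebraMap_sub (isNilpotent_opSum hd N (n + 1) _ _)]
  -- There are `2^(N-n)` boxes, each contributing one logarithm, and `β = 2^N`.
  have h2 : (2 : ℝ) ^ (-(n : ℤ)) = ((2 : ℝ) ^ N)⁻¹ * ((2 ^ (N - n) : ℕ) : ℝ) := by
    rw [zpow_neg, zpow_natCast]
    push_cast
    rw [pow_sub₀ _ (by norm_num) hn]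
    field_simp
  rw [h2]
  push_cast
  ring

/-! ### Partition function and free energy. -/

theorem expectation_average (n : ℕ) (x : Grassmann) :
    expectation (average {n} x) = expectation x := by
  rw [expectation, average_average (Set.subset_univ _), expectation]

theorem expectation_gexp_opSum (hd : ‖dir‖ = 1) (lam h : ℝ) (N j : ℕ) (hj : j ≤ N + 1) :
    partitionFn lam dir N h =
      ((∏ n ∈ Finset.range j, betaC (alphaToEll (coupling lam h n)) ^ 2 ^ (N - n) : ℝ) : ℂ) *
        expectation (gexp (opSum dir N j (2 ^ (N + 1 - j)) (coupling lam h j))) := by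
  induction j with
  | zero => rw [partitionFn, neg_interaction]; simp [coupling]
  | succ j ih =>
    have hj' : j ≤ N := by omega
    -- The tower property allows the average over scale `-j` to be inserted under the full
    -- expectation, where it produces the next factor.
    rw [ih (by omega), ← expectation_average j, two_pow_succ_sub hj',
      average_gexp_opSum hd hj' _ (alphaToEll_coupling_succ lam h j), Finset.prod_range_succ,
      show N + 1 - (j + 1) = N - j by omega]
    simp only [expectation, map_smul, smul_eq_mul]
    push_cast
    ring

/-- Beyond the last scale the sum defining `lowField` is empty, so the exponential left after `N +
1` steps is `1`. -/
theorem op_eq_zero (N k : ℕ) (p : Fin 9) : op dir N (N + 1) k p = 0 := by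
  have h : ∀ s, spinVec N s (N + 1) k = 0 := fun s => by
    ext j
    simp [spinVec, lowField]
  have h1 : dotG (0 : Fin 3 → Grassmann) 0 = 0 := by simp [dotG]
  have h2 : dotR (0 : Fin 3 → Grassmann) dir = 0 := by simp [dotR]
  simp only [op, h, h1, h2, mul_zero, smul_zero]
  fin_cases p <;> rfl

theorem partitionFn_eq (hd : ‖dir‖ = 1) (lam h : ℝ) (N : ℕ) :
    partitionFn lam dir N h = ((∏ n ∈ Finset.range (N + 1),
      betaC (alphaToEll (coupling lam h n)) ^ 2 ^ (N - n) : ℝ) : ℂ) := by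
  rw [expectation_gexp_opSum hd lam h N (N + 1) le_rfl]
  have h0 : opSum dir N (N + 1) (2 ^ (N + 1 - (N + 1))) (coupling lam h (N + 1)) = 0 := by
    simp [opSum, opComb, op_eq_zero]
  rw [h0, gexp_zero, expectation, average_one, map_one, mul_one]

theorem freeEnergy_eq (hd : ‖dir‖ = 1) (lam : ℝ) (N : ℕ) (h : ℝ) :
    freeEnergy lam dir N h = ∑ n ∈ Finset.range (N + 1),
      -(2 : ℝ) ^ (-(n : ℤ)) * Real.log (betaC (alphaToEll (coupling lam h n))) := by
  rw [freeEnergy, partitionFn_eq hd, Complex.ofReal_re, Real.log_prod, Finset.mul_sum]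
  · refine Finset.sum_congr rfl fun n hn => ?_
    have hn' : n ≤ N := Nat.lt_succ_iff.1 (Finset.mem_range.1 hn)
    rw [Real.log_pow, zpow_neg, zpow_natCast]
    push_cast
    rw [pow_sub₀ _ (by norm_num) hn']
    field_simp
  · exact fun n _ => (pow_pos (betaC_pos _) _).ne'

end Direction

/-! ### Smoothness -/

theorem contDiff_betaC : ContDiff ℝ ∞ betaC := by
  unfold betaC
  fun_prop

theorem contDiff_betaMap : ContDiff ℝ ∞ betaMap := by
  unfold betaMap
  refine (contDiff_betaC.inv fun l => (betaC_pos l).ne').smul (contDiff_pi.2 fun j => ?_)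
  fin_cases j <;>
  simp only [Matrix.cons_val, Matrix.cons_val_zero, Matrix.cons_val_one, Fin.zero_eta, Fin.mk_one,
    Fin.reduceFinMk, Fin.isValue] <;>
  fun_prop

/-- The recursion closes on `ℓ` alone, so `ellToAlpha` never has to be differentiated. -/
theorem contDiff_ell (lam : ℝ) (n : ℕ) :
    ContDiff ℝ ∞ fun t => alphaToEll (coupling lam t n) := by
  induction n with
  | zero =>
    refine contDiff_pi.2 fun j => ?_
    fin_cases j <;>
    simp only [alphaToEll, coupling, Matrix.cons_val, Matrix.cons_val_zero, Matrix.cons_val_one,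
      Fin.zero_eta, Fin.mk_one, Fin.reduceFinMk, Fin.isValue] <;>
    fun_prop
  | succ n ih =>
    simp only [alphaToEll_coupling_succ]
    exact contDiff_betaMap.comp ih

/-! ### First and second derivatives along a curve. -/

section ChainRule

variable {E F : Type*} [NormedAddCommGroup E] [NormedSpace ℝ E] [NormedAddCommGroup F]
  [NormedSpace ℝ F] {g : E → F} {γ : ℝ → E}

theorem deriv_comp_curve (hg : ContDiff ℝ ∞ g) (hγ : ContDiff ℝ ∞ γ) (t : ℝ) :
    deriv (fun s => g (γ s)) t = fderiv ℝ g (γ t) (deriv γ t) :=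
  ((hg.differentiable (by simp)).differentiableAt.hasFDerivAt.comp_hasDerivAt t
    (hγ.differentiable (by simp)).differentiableAt.hasDerivAt).deriv

theorem deriv_deriv_comp_curve (hg : ContDiff ℝ ∞ g) (hγ : ContDiff ℝ ∞ γ) (t : ℝ) :
    deriv (deriv fun s => g (γ s)) t =
      fderiv ℝ (fderiv ℝ g) (γ t) (deriv γ t) (deriv γ t) +
        fderiv ℝ g (γ t) (deriv (deriv γ) t) := by
  have h1 : (deriv fun s => g (γ s)) = fun s => fderiv ℝ g (γ s) (deriv γ s) :=
    funext fun s => deriv_comp_curve hg hγ s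
  rw [h1]
  have hg' : ContDiff ℝ ∞ (fderiv ℝ g) := hg.fderiv_right (by simp)
  have hγ' : ContDiff ℝ ∞ (deriv γ) := (contDiff_infty_iff_deriv.1 hγ).2
  have h2 := (hg'.differentiable (by simp)).differentiableAt.hasFDerivAt.comp_hasDerivAt t
    (hγ.differentiable (by simp)).differentiableAt.hasDerivAt
  exact (h2.clm_apply (hγ'.differentiable (by simp)).differentiableAt.hasDerivAt).deriv

end ChainRule

theorem deriv_deriv_log {f : ℝ → ℝ} (hf : ContDiff ℝ ∞ f) (h0 : ∀ t, f t ≠ 0) (t : ℝ) :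
    deriv (deriv fun s => Real.log (f s)) t =
      deriv (deriv f) t / f t - deriv f t ^ 2 / f t ^ 2 := by
  have h1 : (deriv fun s => Real.log (f s)) = fun s => deriv f s / f s := funext fun s =>
    deriv.log (hf.differentiable (by simp)).differentiableAt (h0 s)
  have hf' : ContDiff ℝ ∞ (deriv f) := (contDiff_infty_iff_deriv.1 hf).2
  rw [h1, deriv_fun_div (hf'.differentiable (by simp)).differentiableAt
    (hf.differentiable (by simp)).differentiableAt (h0 t)]
  have := h0 t
  field_simp

theorem contDiff_log_betaC (lam : ℝ) (n : ℕ) :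
    ContDiff ℝ ∞ fun t => Real.log (betaC (alphaToEll (coupling lam t n))) :=
  (contDiff_betaC.comp (contDiff_ell lam n)).log fun _ => (betaC_pos _).ne'

/-! ### Smoothness of the free energy and the susceptibility. -/

variable {dir : EuclideanSpace ℝ (Fin 3)}

theorem contDiff_freeEnergy (hd : ‖dir‖ = 1) (lam : ℝ) (N : ℕ) :
    ContDiff ℝ ∞ (freeEnergy lam dir N) := by
  rw [funext (freeEnergy_eq hd lam N)]
  exact ContDiff.sum fun n _ => contDiff_const.mul (contDiff_log_betaC lam n)

theorem susceptibility_eq (hd : ‖dir‖ = 1) (lam : ℝ) (N : ℕ) (h : ℝ) :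
    susceptibility lam dir N h = ∑ n ∈ Finset.range (N + 1), (2 : ℝ) ^ (-(n : ℤ)) *
      (deriv (deriv fun t => betaC (alphaToEll (coupling lam t n))) h /
          betaC (alphaToEll (coupling lam h n)) -
        (deriv (fun t => betaC (alphaToEll (coupling lam t n))) h) ^ 2 /
          betaC (alphaToEll (coupling lam h n)) ^ 2) := by
  have hL := contDiff_log_betaC lam
  have h1 : deriv (freeEnergy lam dir N) = fun t => ∑ n ∈ Finset.range (N + 1),
      -(2 : ℝ) ^ (-(n : ℤ)) *
        deriv (fun t => Real.log (betaC (alphaToEll (coupling lam t n)))) t := by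
    funext t
    rw [funext (freeEnergy_eq hd lam N), deriv_fun_sum fun n _ =>
      (contDiff_const.mul (hL n)).differentiable (by simp) |>.differentiableAt]
    refine Finset.sum_congr rfl fun n _ => ?_
    exact deriv_const_mul _ ((hL n).differentiable (by simp)).differentiableAt
  have hL' : ∀ n, ContDiff ℝ ∞
      (deriv fun t => Real.log (betaC (alphaToEll (coupling lam t n)))) := fun n =>
    (contDiff_infty_iff_deriv.1 (hL n)).2
  rw [susceptibility, h1, deriv_fun_sum fun n _ =>
    (contDiff_const.mul (hL' n)).differentiable (by simp) |>.differentiableAt,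
    ← Finset.sum_neg_distrib]
  refine Finset.sum_congr rfl fun n _ => ?_
  rw [deriv_const_mul _ ((hL' n).differentiable (by simp)).differentiableAt,
    deriv_deriv_log (f := fun t => betaC (alphaToEll (coupling lam t n)))
      (contDiff_betaC.comp (contDiff_ell lam n)) (fun _ => (betaC_pos _).ne')]
  ring

end HierKondo

end

/-! ### Assembly of the theorem. -/

theorem mainTheorem2 :
    Function.Bijective HierKondo.alphaToEll ∧
    (∀ l : Fin 9 → ℝ, 1 ≤ HierKondo.betaC l) ∧
    (∀ (dir : EuclideanSpace ℝ (Fin 3)), ‖dir‖ = 1 → ∀ N n : ℕ, n ≤ N →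
      (∀ (k : ℕ) (a : Fin 9 → ℝ),
        HierKondo.gexp (HierKondo.opComb dir N n k a) =
            ∑ r ∈ Finset.range 5, ((r.factorial : ℂ)⁻¹) • HierKondo.opComb dir N n k a ^ r ∧
        ∑ r ∈ Finset.range 5, ((r.factorial : ℂ)⁻¹) • HierKondo.opComb dir N n k a ^ r =
            1 + HierKondo.opComb dir N n k (HierKondo.alphaToEll a)) ∧
      (∀ (i : ℕ) (l : Fin 9 → ℝ),
        HierKondo.average {n} ((1 + HierKondo.opComb dir N n (2 * i) l) *
            (1 + HierKondo.opComb dir N n (2 * i + 1) l)) =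
          (HierKondo.betaC l : ℂ) •
            (1 + HierKondo.opComb dir N (n + 1) i (HierKondo.betaMap l)))) ∧
    (∀ lam : ℝ, ∃ α ell : ℝ → ℕ → Fin 9 → ℝ,
      (∀ h, α h 0 = ![lam, 0, 0, 0, 0, h, 0, 0, 0]) ∧
      (∀ h n, ell h n = HierKondo.alphaToEll (α h n)) ∧
      (∀ h n, ell h (n + 1) = HierKondo.betaMap (ell h n)) ∧
      (∀ (dir : EuclideanSpace ℝ (Fin 3)), ‖dir‖ = 1 → ∀ N : ℕ,
        (∀ h : ℝ,
          (∀ n ≤ N,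
            -HierKondo.effPot lam dir N h n =
              ∑ i ∈ Finset.range (2 ^ (N - n)), (HierKondo.opComb dir N n (2 * i) (α h n) +
                HierKondo.opComb dir N n (2 * i + 1) (α h n))) ∧
          (∀ n ≤ N, HierKondo.freeTerm lam dir N h n =
              ((-(2 : ℝ) ^ (-(n : ℤ)) * Real.log (HierKondo.betaC (ell h n)) : ℝ) : ℂ)) ∧
          HierKondo.partitionFn lam dir N h =
              ((∏ n ∈ Finset.range (N + 1),
                HierKondo.betaC (ell h n) ^ 2 ^ (N - n) : ℝ) : ℂ) ∧
          (HierKondo.freeEnergy lam dir N h : ℂ) =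
              ∑ n ∈ Finset.range (N + 1), HierKondo.freeTerm lam dir N h n) ∧
        ContDiff ℝ ∞ (HierKondo.freeEnergy lam dir N) ∧
        (∀ h : ℝ, HierKondo.susceptibility lam dir N h =
          ∑ n ∈ Finset.range (N + 1), (2 : ℝ) ^ (-(n : ℤ)) *
            (deriv (deriv fun t => HierKondo.betaC (ell t n)) h / HierKondo.betaC (ell h n) -
              (deriv (fun t => HierKondo.betaC (ell t n)) h) ^ 2 /
                HierKondo.betaC (ell h n) ^ 2))) ∧
      ContDiff ℝ ∞ HierKondo.betaC ∧
      ContDiff ℝ ∞ HierKondo.betaMap ∧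
      (∀ n, ContDiff ℝ ∞ fun t => ell t n) ∧
      (∀ h n,
        deriv (fun t => HierKondo.betaC (ell t n)) h =
          fderiv ℝ HierKondo.betaC (ell h n) (deriv (fun t => ell t n) h) ∧
        deriv (deriv fun t => HierKondo.betaC (ell t n)) h =
          fderiv ℝ (fderiv ℝ HierKondo.betaC) (ell h n)
              (deriv (fun t => ell t n) h) (deriv (fun t => ell t n) h) +
            fderiv ℝ HierKondo.betaC (ell h n) (deriv (deriv fun t => ell t n) h) ∧
        deriv (fun t => ell t (n + 1)) h =
          fderiv ℝ HierKondo.betaMap (ell h n) (deriv (fun t => ell t n) h) ∧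
        deriv (deriv fun t => ell t (n + 1)) h =
          fderiv ℝ (fderiv ℝ HierKondo.betaMap) (ell h n)
              (deriv (fun t => ell t n) h) (deriv (fun t => ell t n) h) +
            fderiv ℝ HierKondo.betaMap (ell h n) (deriv (deriv fun t => ell t n) h))) := by
  open HierKondo in
  refine ⟨alphaToEll_bijective, one_le_betaC, fun dir hd N n hn => ⟨fun k a => ⟨?_, ?_⟩,
    average_one_add_opComb hd hn⟩, fun lam => ⟨coupling lam, fun h n => alphaToEll (coupling lam h n),
    fun _ => rfl, fun _ _ => rfl, alphaToEll_coupling_succ lam, fun dir hd N =>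
      ⟨fun h => ⟨fun n hn => ?_, freeTerm_eq hd lam h N, partitionFn_eq hd lam h N, ?_⟩,
        contDiff_freeEnergy hd lam N, susceptibility_eq hd lam N⟩,
    contDiff_betaC, contDiff_betaMap, contDiff_ell lam, fun h n => ⟨?_, ?_, ?_, ?_⟩⟩⟩
  · exact gexp_eq_sum (opComb_pow_five hd N n k a)
  · exact sum_opComb_pow hd N n k a
  · rw [neg_effPot hd lam h N n (by omega), two_pow_succ_sub hn, opSum_two_mul]
  · rw [freeEnergy_eq hd, Complex.ofReal_sum]
    exact Finset.sum_congr rfl fun n hn =>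
      (freeTerm_eq hd lam h N n (Nat.lt_succ_iff.1 (Finset.mem_range.1 hn))).symm
  · exact deriv_comp_curve contDiff_betaC (contDiff_ell lam n) h
  · exact deriv_deriv_comp_curve contDiff_betaC (contDiff_ell lam n) h
  · simp only [alphaToEll_coupling_succ]
    exact deriv_comp_curve contDiff_betaMap (contDiff_ell lam n) h
  · simp only [alphaToEll_coupling_succ]
    exact deriv_deriv_comp_curve contDiff_betaMap (contDiff_ell lam n) h
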